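/- Let $X$ be a locally compact separable metric space, let $m$ be a Radon measure on $X$ of full support, and let $Q$, with domain $D(Q)$, be a regular Dirichlet form on the real space $L^2(X,m)$. That is, $Q$ is a densely defined closed nonnegative quadratic form such that $f\in D(Q)$ implies $f_+\wedge 1\in D(Q)$ and $Q(f_+\wedge 1)\le Q(f)$, and $D(Q)\cap C_c(X)$ is uniformly dense in $C_c(X)$ and dense in $D(Q)$ with respect to the form norm $\|f\|_Q=(Q(f)+\|f\|_{L^2}^2)^{1/2}$. The capacity of an open set $U\subseteq X$ is $\operatorname{cap}(U)=\inf\{\|f\|_Q^2 : f\in D(Q),\ f\ge 1\ m\text{-a.e. on }U\}$ (with $\inf\emptyset=\infty$), and the capacity of an arbitrary $A\subseteq X$ is $\operatorname{cap}(A)=\inf\{\operatorname{cap}(U): U\text{ open},\ A\subseteq U\}$. A property holds quasi everywhere (q.e.) if it holds off a set of capacity zero. A measurable $g:X\to[-\infty,\infty]$ is quasi continuous if for every $\varepsilon>0$ there is an open $U$ with $\operatorname{cap}(U)<\varepsilon$ such that $g|_{X\setminus U}$ is finite-valued and continuous. For $f\in D(Q)$, $\tilde f$ denotes a quasi continuous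 representative of $f$, which is unique up to equality q.e. Let $O\subseteq X$ be open and let $\mu$ be a Radon measure on the Borel $\sigma$-algebra of $O$. Define the quadratic form $Q^c_{O,\mu}$ on $L^2(X,m)$ by $$D(Q^c_{O,\mu})=D(Q)\cap C_c(O),\qquad Q^c_{O,\mu}(f)=Q(f)+\int_O f^2\,d\mu,$$ where $C_c(O)$ is identified with $\{\varphi\in C_c(X):\operatorname{supp}\varphi\subseteq O\}$. Then the following are equivalent: (i) $\mu$ charges no set of capacity zero, i.e. $\mu(A)=0$ for every Borel set $A\subseteq O$ with $\operatorname{cap}(A)=0$. (ii) The quadratic form $Q^c_{O,\mu}$ is closable, i.e. it has a closed extension in $L^2(X,m)$. In this case, the closure (smallest closed extension) $Q_{O,\mu}$ of $Q^c_{O,\mu}$ is given by $$D(Q_{O,\mu})=\Big\{f\in D(Q) : \tilde f=0\text{ q.e. on }X\setminus O\ \text{ and }\ \int_O\tilde f^2\,d\mu<\infty\Big\},\qquad Q_{O,\mu}(f)=Q(f)+\int_O\tilde f^2\,d\mu .$$ -/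

import Mathlib

open MeasureTheory Filter Topology
open scoped ENNReal CompactlySupported

/-- A nonnegative quadratic form on a real Hilbert space `H`, defined on a linear subspace. -/
structure NonnegForm (H : Type*) [NormedAddCommGroup H] [InnerProductSpace ℝ H] where
  /-- the domain `D(Q)` -/
  domain : Submodule ℝ H
  /-- the quadratic form `f ↦ Q(f)` on `D(Q)` -/
  form : QuadraticForm ℝ domain
  nonneg : ∀ f : domain, 0 ≤ form f

namespace NonnegForm

section Hilbert

variable {H : Type*} [NormedAddCommGroup H] [InnerProductSpace ℝ H]

/-- The square of the form norm, `Q(f) + ‖f‖²`. -/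
def normSq (Q : NonnegForm H) (f : Q.domain) : ℝ :=
  Q.form f + ‖(f : H)‖ ^ 2

/-- `Q` is closed: `D(Q)` with the form norm is complete. -/
def IsClosed (Q : NonnegForm H) : Prop :=
  ∀ u : ℕ → Q.domain,
    (∀ ε : ℝ, 0 < ε → ∃ N : ℕ, ∀ n k : ℕ, N ≤ n → N ≤ k → Q.normSq (u n - u k) < ε) →
    ∃ f : Q.domain, Tendsto (fun n => Q.normSq (u n - f)) atTop (𝓝 0)

/-- `Q'` is an extension of `Q`: `D(Q) ⊆ D(Q')` and `Q' = Q` on `D(Q)`. -/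
def Extends (Q' Q : NonnegForm H) : Prop :=
  ∃ h : Q.domain ≤ Q'.domain, ∀ f : Q.domain, Q'.form (Submodule.inclusion h f) = Q.form f

/-- `Q` is closable: it has a closed extension. -/
def IsClosable (Q : NonnegForm H) : Prop :=
  ∃ Q' : NonnegForm H, Q'.IsClosed ∧ Q'.Extends Q

/-- `C` is the closure of `Q`: the smallest closed extension of `Q`. -/
def IsClosureOf (C Q : NonnegForm H) : Prop :=
  C.IsClosed ∧ C.Extends Q ∧ ∀ R : NonnegForm H, R.IsClosed → R.Extends Q → R.Extends C

end Hilbert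

section Dirichlet

variable {X : Type*} [MeasurableSpace X] {m : Measure X}

/-- `Q` is a Dirichlet form on `L²(X, m)`: it is densely defined and closed, and for `f ∈ D(Q)` the
function `f₊ ∧ 1` is in `D(Q)` with `Q(f₊ ∧ 1) ≤ Q(f)`. -/
def IsDirichlet (Q : NonnegForm (Lp ℝ 2 m)) : Prop :=
  Dense (Q.domain : Set (Lp ℝ 2 m)) ∧ Q.IsClosed ∧
    ∀ f : Q.domain, ∃ g : Q.domain,
      (∀ᵐ x ∂m, (g : Lp ℝ 2 m) x = min (max ((f : Lp ℝ 2 m) x) 0) 1) ∧ Q.form g ≤ Q.form f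

end Dirichlet

section Regular

variable {X : Type*} [TopologicalSpace X] [MeasurableSpace X] [BorelSpace X]

/-- The linear map sending a function in `C_c(X)` to its class in `L²(X, m)`. -/
noncomputable def toL2 (m : Measure X) [IsFiniteMeasureOnCompacts m] :
    C_c(X, ℝ) →ₗ[ℝ] Lp ℝ 2 m where
  toFun φ := (φ.continuous.memLp_of_hasCompactSupport (μ := m) (p := 2) φ.hasCompactSupport).toLp φ
  map_add' _ _ := rfl
  map_smul' _ _ := rfl

theorem toL2_injective (m : Measure X) [IsFiniteMeasureOnCompacts m] [m.IsOpenPosMeasure] :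
    Function.Injective (toL2 m) := by
  intro φ ψ h
  have h' : (φ : X → ℝ) =ᵐ[m] ψ := (MemLp.toLp_eq_toLp_iff
    (φ.continuous.memLp_of_hasCompactSupport φ.hasCompactSupport)
    (ψ.continuous.memLp_of_hasCompactSupport ψ.hasCompactSupport)).1 h
  exact DFunLike.coe_injective ((φ.continuous.ae_eq_iff_eq m ψ.continuous).1 h')

/-- The regularity of a form on `L²(X, m)`: `D(Q) ∩ C_c(X)` is uniformly dense in `C_c(X)`, and it
is dense in `D(Q)` with respect to the form norm. -/
def IsRegular {m : Measure X} [IsFiniteMeasureOnCompacts m] (Q : NonnegForm (Lp ℝ 2 m)) : Prop :=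
  (∀ φ : C_c(X, ℝ), ∀ ε : ℝ, 0 < ε →
    ∃ ψ : C_c(X, ℝ), toL2 m ψ ∈ Q.domain ∧ ∀ x, |φ x - ψ x| < ε) ∧
  (∀ f : Q.domain, ∀ ε : ℝ, 0 < ε →
    ∃ (ψ : C_c(X, ℝ)) (hψ : toL2 m ψ ∈ Q.domain), Q.normSq (f - ⟨toL2 m ψ, hψ⟩) < ε)

/-- The capacity of an open set `U`: the infimum of `Q(f) + ‖f‖²` over all `f ∈ D(Q)` with `f ≥ 1`
`m`-a.e. on `U` (it is `∞` if there is no such `f`). -/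
noncomputable def capOpen {m : Measure X} (Q : NonnegForm (Lp ℝ 2 m)) (U : Set X) : ℝ≥0∞ :=
  ⨅ (f : Q.domain) (_ : ∀ᵐ x ∂m, x ∈ U → 1 ≤ (f : Lp ℝ 2 m) x), ENNReal.ofReal (Q.normSq f)

/-- The capacity of an arbitrary set: the infimum of the capacities of its open supersets. -/
noncomputable def cap {m : Measure X} (Q : NonnegForm (Lp ℝ 2 m)) (A : Set X) : ℝ≥0∞ :=
  ⨅ (U : Set X) (_ : IsOpen U) (_ : A ⊆ U), Q.capOpen U

/-- The property `p` holds quasi everywhere: off a set of capacity zero. -/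
def QuasiEverywhere {m : Measure X} (Q : NonnegForm (Lp ℝ 2 m)) (p : X → Prop) : Prop :=
  Q.cap {x | ¬ p x} = 0

/-- A measurable function `g : X → [-∞, ∞]` is quasi continuous if for every `ε > 0` there is an
open set of capacity less than `ε` off which `g` is finite-valued and continuous. -/
def IsQuasiContinuous {m : Measure X} (Q : NonnegForm (Lp ℝ 2 m)) (g : X → EReal) : Prop :=
  Measurable g ∧ ∀ ε : ℝ≥0∞, 0 < ε → ∃ U : Set X, IsOpen U ∧ Q.cap U < ε ∧
    (∀ x ∈ Uᶜ, g x ≠ ⊥ ∧ g x ≠ ⊤) ∧ ContinuousOn g Uᶜ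

/-- `g` is a quasi continuous representative of `f ∈ L²(X, m)`. -/
def IsQuasiContinuousRep {m : Measure X} (Q : NonnegForm (Lp ℝ 2 m)) (f : Lp ℝ 2 m)
    (g : X → EReal) : Prop :=
  Q.IsQuasiContinuous g ∧ ∀ᵐ x ∂m, g x = ((f x : ℝ) : EReal)

/-- The measure `μ` on `O` charges no (Borel) set of capacity zero. -/
def ChargesNoPolarSet {m : Measure X} (Q : NonnegForm (Lp ℝ 2 m)) {O : Set X} (μ : Measure O) :
    Prop :=
  ∀ A : Set O, MeasurableSet A → Q.cap (Subtype.val '' A) = 0 → μ A = 0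

/-- `C_c(O)`, identified with the functions in `C_c(X)` whose support is contained in `O`. -/
def ccOn (O : Set X) : Submodule ℝ C_c(X, ℝ) where
  carrier := {φ | tsupport φ ⊆ O}
  add_mem' {φ ψ} hφ hψ := (tsupport_add (φ : X → ℝ) ψ).trans (Set.union_subset hφ hψ)
  zero_mem' := by simp [tsupport]
  smul_mem' c φ hφ :=
    (closure_mono (Function.support_const_smul_subset c (φ : X → ℝ))).trans hφ

theorem integrable_mul_ccOn {O : Set X} (μ : Measure O) [IsFiniteMeasureOnCompacts μ]
    (φ ψ : ccOn O) : Integrable (fun x : O => φ.1 x * ψ.1 x) μ := by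
  refine Continuous.integrable_of_hasCompactSupport
    ((φ.1.continuous.comp continuous_subtype_val).mul
      (ψ.1.continuous.comp continuous_subtype_val)) ?_
  have hK : IsCompact (Subtype.val ⁻¹' tsupport φ.1 : Set O) := by
    rw [Subtype.isCompact_iff, Subtype.image_preimage_coe, Set.inter_eq_right.2 φ.2]
    exact φ.1.hasCompactSupport
  refine hK.of_isClosed_subset (isClosed_tsupport _) ?_
  refine closure_minimal (fun x hx => subset_tsupport _ ?_)
    ((isClosed_tsupport _).preimage continuous_subtype_val)
  exact left_ne_zero_of_mul hx

/-- The quadratic form `φ ↦ ∫_O φ² dμ` on `C_c(O)`. -/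
noncomputable def measureForm {O : Set X} (μ : Measure O) [IsFiniteMeasureOnCompacts μ] :
    QuadraticForm ℝ (ccOn O) :=
  LinearMap.BilinMap.toQuadraticMap <|
    LinearMap.mk₂ ℝ (fun φ ψ : ccOn O => ∫ x : O, φ.1 x * ψ.1 x ∂μ)
      (fun φ φ' ψ => by
        rw [← integral_add (integrable_mul_ccOn μ φ ψ) (integrable_mul_ccOn μ φ' ψ)]
        exact integral_congr_ae (Eventually.of_forall fun x => add_mul _ _ _))
      (fun c φ ψ => by
        rw [smul_eq_mul, ← integral_const_mul]
        exact integral_congr_ae (Eventually.of_forall fun x => mul_assoc _ _ _))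
      (fun φ ψ ψ' => by
        rw [← integral_add (integrable_mul_ccOn μ φ ψ) (integrable_mul_ccOn μ φ ψ')]
        exact integral_congr_ae (Eventually.of_forall fun x => mul_add _ _ _))
      (fun c φ ψ => by
        rw [smul_eq_mul, ← integral_const_mul]
        exact integral_congr_ae (Eventually.of_forall fun x => mul_left_comm _ _ _))

theorem measureForm_apply {O : Set X} (μ : Measure O) [IsFiniteMeasureOnCompacts μ] (φ : ccOn O) :
    measureForm μ φ = ∫ x : O, φ.1 x ^ 2 ∂μ := by
  simp [measureForm, LinearMap.BilinMap.toQuadraticMap_apply, sq]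

section Part

variable (m : Measure X) [IsFiniteMeasureOnCompacts m]

/-- The image of `C_c(O)` in `L²(X, m)`. -/
noncomputable def ccOnL2 (O : Set X) : Submodule ℝ (Lp ℝ 2 m) :=
  LinearMap.range ((toL2 m).domRestrict (ccOn O))

/-- As `m` has full support, a class in the image of `C_c(O)` in `L²(X, m)` has a unique
representative in `C_c(O)`; this is the linear map which selects it. -/
noncomputable def ccRep [m.IsOpenPosMeasure] (O : Set X) : ccOnL2 m O →ₗ[ℝ] ccOn O :=
  (LinearEquiv.ofInjective ((toL2 m).domRestrict (ccOn O))
    ((toL2_injective m).comp Subtype.val_injective)).symm.toLinearMap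

theorem ccRep_toL2 [m.IsOpenPosMeasure] (O : Set X) (φ : ccOn O) (h : toL2 m φ.1 ∈ ccOnL2 m O) :
    ccRep m O ⟨toL2 m φ.1, h⟩ = φ :=
  (LinearEquiv.ofInjective ((toL2 m).domRestrict (ccOn O))
    ((toL2_injective m).comp Subtype.val_injective)).symm_apply_apply φ

end Part

variable {m : Measure X} [IsFiniteMeasureOnCompacts m] [m.IsOpenPosMeasure]

/-- The form `f ↦ Q(f) + ∫_O f² dμ` with domain `D(Q) ∩ C_c(O)`; in the integral `f` is the
representative in `C_c(O)`. -/
noncomputable def addMeasure (Q : NonnegForm (Lp ℝ 2 m)) {O : Set X} (μ : Measure O)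
    [IsFiniteMeasureOnCompacts μ] : NonnegForm (Lp ℝ 2 m) where
  domain := Q.domain ⊓ ccOnL2 m O
  form := Q.form.comp (Submodule.inclusion inf_le_left) +
    (measureForm μ).comp (ccRep m O ∘ₗ Submodule.inclusion inf_le_right)
  nonneg f := by
    refine add_nonneg (Q.nonneg _) ?_
    change 0 ≤ measureForm μ _
    rw [measureForm_apply]
    exact integral_nonneg fun x => sq_nonneg _

theorem mem_addMeasure_domain (Q : NonnegForm (Lp ℝ 2 m)) {O : Set X} (μ : Measure O)
    [IsFiniteMeasureOnCompacts μ] (f : Lp ℝ 2 m) :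
    f ∈ (Q.addMeasure μ).domain ↔
      f ∈ Q.domain ∧ ∃ φ : C_c(X, ℝ), tsupport φ ⊆ O ∧ toL2 m φ = f := by
  refine and_congr_right fun _ => ⟨?_, ?_⟩
  · rintro ⟨φ, h⟩
    exact ⟨φ.1, φ.2, h⟩
  · rintro ⟨φ, hφ, h⟩
    exact ⟨⟨φ, hφ⟩, h⟩

theorem addMeasure_form (Q : NonnegForm (Lp ℝ 2 m)) {O : Set X} (μ : Measure O)
    [IsFiniteMeasureOnCompacts μ] (φ : C_c(X, ℝ)) (hφ : tsupport φ ⊆ O)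
    (h : toL2 m φ ∈ (Q.addMeasure μ).domain) :
    (Q.addMeasure μ).form ⟨toL2 m φ, h⟩ = Q.form ⟨toL2 m φ, h.1⟩ + ∫ x : O, φ x ^ 2 ∂μ := by
  have key : ccRep m O ⟨toL2 m φ, h.2⟩ = ⟨φ, hφ⟩ := ccRep_toL2 m O ⟨φ, hφ⟩ h.2
  change Q.form ⟨toL2 m φ, h.1⟩ + measureForm μ (ccRep m O ⟨toL2 m φ, h.2⟩) = _
  rw [key, measureForm_apply]

end Regular

end NonnegForm

/-!
The argument uses only lattice operations in `D(Q)`, and rests on one fact about closed forms,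
`NonnegForm.IsClosed.exists_convexHull`: if a sequence of bounded energy converges in the Hilbert
space, then its limit lies in the domain and is a limit of convex combinations in the form norm.
Energy bounds and convergence in `L²` are therefore enough throughout, and constants do not matter.
In particular `Q(f₊) ≤ Q(f)`, and `D(Q)` is a lattice with bounds on the energies of `f ⊓ g` and
`f ⊔ g`.

If `μ` charges no polar set, then `f ↦ f̃` is a well defined map into `L²(O, μ)` on the space of all
`f ∈ D(Q)` whose quasi continuous representative `f̃` vanishes quasi everywhere off `O` and is square
integrable. Convergence in `D(Q)` implies convergence quasi everywhere of a subsequence, so the form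
`Q(f) + ‖f̃‖²` on this space is closed (`NonnegForm.perturbedForm_isClosed`). It is the closure of
the form on `D(Q) ∩ C_c(O)` because that space is dense (`NonnegForm.mem_coreClosure`). For the
density one reduces to `0 ≤ f ≤ N` and to `(f - ε)₊`. Off an open set `U` of small capacity `f̃` is
continuous and vanishes outside `O`, so that `{f̃ ≥ ε} \ U` is closed and contained in `O`;
subtracting `N e`, where `e ≥ 1` on `U` has small form norm, and taking the positive part gives a
function which vanishes off this closed set. Intersecting with regular approximations makes the
support compact, and a cutoff function makes the approximations continuous.

Conversely, let the form be closable and let `K ⊆ O` be a compact set of capacity zero. There are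
`φ n ∈ D(Q) ∩ C_c(O)` with `φ n ≥ 1` on `K`, of bounded energy and converging to zero in `L²(X, m)`
(`NonnegForm.IsRegular.exists_one_le` and a fixed cutoff function). By the fact above, applied to a
closed extension, some convex combinations `w` have small energy; as `w ≥ 1` on `K`, this gives
`μ(K) ≤ ∫ w² dμ`, which is arbitrarily small. Inner regularity of `μ` extends this to Borel sets.
-/

/-! ### Closed forms on a Hilbert space -/

namespace NonnegForm

section GeneralForms

variable {H : Type*} [NormedAddCommGroup H] [InnerProductSpace ℝ H]

theorem normSq_nonneg (Q : NonnegForm H) (f : Q.domain) : 0 ≤ Q.normSq f :=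
  add_nonneg (Q.nonneg f) (sq_nonneg _)

theorem form_le_normSq (Q : NonnegForm H) (f : Q.domain) : Q.form f ≤ Q.normSq f :=
  le_add_of_nonneg_right (sq_nonneg _)

theorem sq_norm_le_normSq (Q : NonnegForm H) (f : Q.domain) : ‖(f : H)‖ ^ 2 ≤ Q.normSq f :=
  le_add_of_nonneg_left (Q.nonneg f)

theorem form_smul (Q : NonnegForm H) (c : ℝ) (f : Q.domain) :
    Q.form (c • f) = c ^ 2 * Q.form f := by
  rw [QuadraticMap.map_smul, smul_eq_mul, sq]

theorem form_neg (Q : NonnegForm H) (f : Q.domain) : Q.form (-f) = Q.form f :=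
  QuadraticMap.map_neg _ _

theorem form_parallelogram (Q : NonnegForm H) (f g : Q.domain) :
    Q.form (f + g) + Q.form (f - g) = 2 * Q.form f + 2 * Q.form g := by
  have h1 := QuadraticMap.map_add Q.form f g
  have h2 := QuadraticMap.map_add Q.form f (-g)
  rw [QuadraticMap.polar_neg_right, form_neg, ← sub_eq_add_neg] at h2
  linarith

theorem normSq_parallelogram (Q : NonnegForm H) (f g : Q.domain) :
    Q.normSq (f + g) + Q.normSq (f - g) = 2 * Q.normSq f + 2 * Q.normSq g := by
  have h1 := Q.form_parallelogram f g
  have h2 := parallelogram_law_with_norm ℝ (f : H) (g : H)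
  simp only [normSq, Submodule.coe_add, Submodule.coe_sub]
  nlinarith

theorem form_sub_le (Q : NonnegForm H) (f g : Q.domain) :
    Q.form (f - g) ≤ 2 * Q.form f + 2 * Q.form g := by
  linarith [Q.form_parallelogram f g, Q.nonneg (f + g)]

theorem normSq_add_le (Q : NonnegForm H) (f g : Q.domain) :
    Q.normSq (f + g) ≤ 2 * Q.normSq f + 2 * Q.normSq g := by
  linarith [Q.normSq_parallelogram f g, Q.normSq_nonneg (f - g)]

theorem normSq_zero (Q : NonnegForm H) : Q.normSq 0 = 0 := by
  simp [normSq]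

theorem normSq_smul (Q : NonnegForm H) (c : ℝ) (f : Q.domain) :
    Q.normSq (c • f) = c ^ 2 * Q.normSq f := by
  simp only [normSq, form_smul, Submodule.coe_smul, norm_smul, mul_pow, Real.norm_eq_abs, sq_abs]
  ring

theorem normSq_neg (Q : NonnegForm H) (f : Q.domain) : Q.normSq (-f) = Q.normSq f := by
  simp [normSq]

theorem normSq_sub_comm (Q : NonnegForm H) (f g : Q.domain) :
    Q.normSq (f - g) = Q.normSq (g - f) := by
  rw [← neg_sub, normSq_neg]

theorem normSq_sub_le_sub_add_sub (Q : NonnegForm H) (f g h : Q.domain) :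
    Q.normSq (f - h) ≤ 2 * Q.normSq (f - g) + 2 * Q.normSq (g - h) := by
  simpa using Q.normSq_add_le (f - g) (g - h)

/-- The Cauchy–Schwarz inequality for the polar form of a nonnegative form. -/
theorem polar_sq_le (Q : NonnegForm H) (f g : Q.domain) :
    QuadraticMap.polar Q.form f g ^ 2 ≤ 4 * Q.form f * Q.form g := by
  have h : ∀ x : ℝ, 0 ≤ Q.form f * (x * x) + QuadraticMap.polar Q.form f g * x + Q.form g := by
    intro x
    have h1 := Q.nonneg (x • f + g)
    rw [QuadraticMap.map_add Q.form, form_smul, QuadraticMap.polar_smul_left, smul_eq_mul] at h1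
    linarith
  have := discrim_le_zero h
  rw [discrim] at this
  linarith

theorem tendsto_form (Q : NonnegForm H) {u : ℕ → Q.domain} {f : Q.domain}
    (h : Tendsto (fun n => Q.form (u n - f)) atTop (𝓝 0)) :
    Tendsto (fun n => Q.form (u n)) atTop (𝓝 (Q.form f)) := by
  have h1 : ∀ n, Q.form (u n) =
      Q.form f + Q.form (u n - f) + QuadraticMap.polar Q.form f (u n - f) := by
    intro n
    rw [← QuadraticMap.map_add Q.form, add_sub_cancel]
  have h2 : Tendsto (fun n => Real.sqrt (4 * Q.form f * Q.form (u n - f))) atTop (𝓝 0) := by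
    simpa using (h.const_mul (4 * Q.form f)).sqrt
  have h3 : Tendsto (fun n => QuadraticMap.polar Q.form f (u n - f)) atTop (𝓝 0) :=
    squeeze_zero_norm (fun n => Real.abs_le_sqrt (Q.polar_sq_le _ _)) h2
  simpa [h1] using (h.const_add (Q.form f)).add h3

theorem tendsto_form_of_normSq (Q : NonnegForm H) {u : ℕ → Q.domain} {f : Q.domain}
    (h : Tendsto (fun n => Q.normSq (u n - f)) atTop (𝓝 0)) :
    Tendsto (fun n => Q.form (u n)) atTop (𝓝 (Q.form f)) :=
  Q.tendsto_form (squeeze_zero (fun _ => Q.nonneg _) (fun _ => Q.form_le_normSq _) h)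

theorem tendsto_coe_of_normSq (Q : NonnegForm H) {u : ℕ → Q.domain} {f : Q.domain}
    (h : Tendsto (fun n => Q.normSq (u n - f)) atTop (𝓝 0)) :
    Tendsto (fun n => (u n : H)) atTop (𝓝 (f : H)) := by
  rw [tendsto_iff_norm_sub_tendsto_zero]
  have h2 := (squeeze_zero (fun n => sq_nonneg ‖((u n - f : Q.domain) : H)‖)
    (fun n => Q.sq_norm_le_normSq _) h).sqrt
  simpa [Real.sqrt_sq] using h2

/-- Sublevel sets of the form are convex. -/
theorem convex_form_le (Q : NonnegForm H) (B : ℝ) : Convex ℝ {f : Q.domain | Q.form f ≤ B} := by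
  intro f hf g hg a b ha hb hab
  simp only [Set.mem_ofPred_eq] at hf hg ⊢
  have h1 := Q.nonneg (f - g)
  rw [sub_eq_add_neg, QuadraticMap.map_add Q.form, form_neg, QuadraticMap.polar_neg_right] at h1
  rw [QuadraticMap.map_add Q.form, form_smul, form_smul, QuadraticMap.polar_smul_left,
    QuadraticMap.polar_smul_right, smul_eq_mul, smul_eq_mul]
  have hb' : b = 1 - a := by linarith
  subst hb'
  nlinarith [mul_nonneg ha hb, mul_le_mul_of_nonneg_left hf ha, mul_le_mul_of_nonneg_left hg hb,
    mul_le_mul_of_nonneg_left h1 (mul_nonneg ha hb)]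

/-- A closed form is weakly lower semicontinuous: if `u n → y` in `H` with bounded energies, then
`y` lies in the domain, with the same bound for its energy, and `y` is a limit in the form norm of
convex combinations of the `u n`. The combinations are almost minimizers of the form norm on the
convex hulls of the tails; by the parallelogram law they form a Cauchy sequence. -/
theorem IsClosed.exists_convexHull {Q : NonnegForm H} (hQ : Q.IsClosed) {u : ℕ → Q.domain}
    {B : ℝ} (hB : ∀ n, Q.form (u n) ≤ B) {y : H}
    (hy : Tendsto (fun n => (u n : H)) atTop (𝓝 y)) :
    ∃ f : Q.domain, (f : H) = y ∧ Q.form f ≤ B ∧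
      ∀ ε : ℝ, 0 < ε → ∃ v ∈ convexHull ℝ (Set.range u), Q.normSq (v - f) < ε := by
  obtain ⟨D, hD⟩ : ∃ D : ℝ, ∀ n, Q.normSq (u n) ≤ D := by
    obtain ⟨D, hD⟩ := hy.norm.bddAbove_range
    refine ⟨B + D ^ 2, fun n => add_le_add (hB n) ?_⟩
    exact pow_le_pow_left₀ (norm_nonneg _) (hD ⟨n, rfl⟩) 2
  set A : ℕ → Set Q.domain := fun n => convexHull ℝ (u '' Set.Ici n) with hA
  have hAanti : Antitone A := fun n k hnk =>
    convexHull_mono (Set.image_mono (Set.Ici_subset_Ici.2 hnk))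
  have hbdd : ∀ n, BddBelow (Q.normSq '' A n) := fun n =>
    ⟨0, by rintro _ ⟨f, -, rfl⟩; exact Q.normSq_nonneg f⟩
  have hne : ∀ n, u n ∈ A n := fun n => subset_convexHull _ _ ⟨n, Set.self_mem_Ici, rfl⟩
  set d : ℕ → ℝ := fun n => sInf (Q.normSq '' A n) with hd
  have hdmono : Monotone d := fun n k hnk =>
    csInf_le_csInf (hbdd n) ⟨_, _, hne k, rfl⟩ (Set.image_mono (hAanti hnk))
  have hdbdd : BddAbove (Set.range d) := by
    refine ⟨D, ?_⟩
    rintro _ ⟨n, rfl⟩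
    exact (csInf_le (hbdd n) ⟨_, hne n, rfl⟩).trans (hD n)
  have hdlim := tendsto_atTop_ciSup hdmono hdbdd
  set L := ⨆ n, d n
  have hdL : ∀ n, d n ≤ L := fun n => le_ciSup hdbdd n
  have hp : ∀ n : ℕ, ∃ p ∈ A n, Q.normSq p < d n + 1 / ((n : ℝ) + 1) := by
    intro n
    obtain ⟨_, ⟨p, hp, rfl⟩, h⟩ := exists_lt_of_csInf_lt (s := Q.normSq '' A n) ⟨_, _, hne n, rfl⟩
      (lt_add_of_pos_right (d n) (Nat.one_div_pos_of_nat (α := ℝ) (n := n)))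
    exact ⟨p, hp, h⟩
  choose p hpA hpd using hp
  obtain ⟨f, hf⟩ := hQ p (by
    intro ε hε
    have h1 : Tendsto (fun N => 4 * (L - d N) + 4 * (1 / ((N : ℝ) + 1))) atTop (𝓝 0) := by
      simpa using ((hdlim.const_sub L).const_mul 4).add
        ((tendsto_one_div_add_atTop_nhds_zero_nat (𝕜 := ℝ)).const_mul 4)
    obtain ⟨N, hN⟩ := (h1.eventually (gt_mem_nhds hε)).exists
    refine ⟨N, fun n k hn hk => lt_of_le_of_lt ?_ hN⟩
    have h2 : d N ≤ Q.normSq ((1 / 2 : ℝ) • p n + (1 / 2 : ℝ) • p k) := by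
      refine csInf_le (hbdd N) ⟨_, ?_, rfl⟩
      exact convex_convexHull ℝ _ (hAanti hn (hpA n)) (hAanti hk (hpA k)) (by norm_num)
        (by norm_num) (by norm_num)
    rw [← smul_add, normSq_smul] at h2
    have h3 := Q.normSq_parallelogram (p n) (p k)
    have h4 : 1 / ((n : ℝ) + 1) ≤ 1 / ((N : ℝ) + 1) := Nat.one_div_le_one_div hn
    have h5 : 1 / ((k : ℝ) + 1) ≤ 1 / ((N : ℝ) + 1) := Nat.one_div_le_one_div hk
    linarith [hpd n, hpd k, hdL n, hdL k])
  have hpf := Q.tendsto_coe_of_normSq hf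
  have hpy : Tendsto (fun n => (p n : H)) atTop (𝓝 y) := by
    rw [Metric.tendsto_atTop] at hy ⊢
    intro ε hε
    obtain ⟨N, hN⟩ := hy ε hε
    refine ⟨N, fun n hn => ?_⟩
    have : A n ⊆ (Q.domain.subtype : Q.domain →ₗ[ℝ] H) ⁻¹' Metric.ball y ε := by
      refine convexHull_min ?_ ((convex_ball y ε).linear_preimage _)
      rintro _ ⟨k, hk, rfl⟩
      exact hN k (hn.trans hk)
    exact this (hpA n)
  refine ⟨f, tendsto_nhds_unique hpf hpy, ?_, ?_⟩
  · refine le_of_tendsto' (Q.tendsto_form_of_normSq hf) fun n => ?_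
    refine convexHull_min ?_ (Q.convex_form_le B) (hpA n)
    rintro _ ⟨k, -, rfl⟩
    exact hB k
  · intro ε hε
    obtain ⟨n, hn⟩ := (hf.eventually (gt_mem_nhds hε)).exists
    exact ⟨p n, convexHull_mono (Set.image_subset_range _ _) (hpA n), hn⟩

/-- The elements of `D(Q)` which are approximable in the form norm by elements of `D(Q) ∩ E`. -/
def formClosure (Q : NonnegForm H) (E : Submodule ℝ H) : Submodule ℝ Q.domain where
  carrier := {f | ∀ ε : ℝ, 0 < ε → ∃ e : Q.domain, (e : H) ∈ E ∧ Q.normSq (e - f) < ε}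
  add_mem' {f g} hf hg ε hε := by
    obtain ⟨a, ha, ha'⟩ := hf (ε / 4) (by positivity)
    obtain ⟨b, hb, hb'⟩ := hg (ε / 4) (by positivity)
    refine ⟨a + b, E.add_mem ha hb, ?_⟩
    rw [add_sub_add_comm]
    linarith [Q.normSq_add_le (a - f) (b - g)]
  zero_mem' ε hε := ⟨0, E.zero_mem, by simpa [normSq_zero] using hε⟩
  smul_mem' c f hf ε hε := by
    obtain ⟨a, ha, ha'⟩ := hf (ε / (c ^ 2 + 1)) (by positivity)
    refine ⟨c • a, E.smul_mem c ha, ?_⟩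
    rw [← smul_sub, normSq_smul]
    rw [lt_div_iff₀ (by positivity)] at ha'
    nlinarith [Q.normSq_nonneg (a - f)]

theorem mem_formClosure_of_mem (Q : NonnegForm H) {E : Submodule ℝ H} {f : Q.domain}
    (hf : (f : H) ∈ E) : f ∈ Q.formClosure E :=
  fun ε hε => ⟨f, hf, by simpa [normSq_zero] using hε⟩

theorem IsClosed.mem_formClosure_of_tendsto {Q : NonnegForm H} (hQ : Q.IsClosed)
    {E : Submodule ℝ H} {u : ℕ → Q.domain} (hu : ∀ n, u n ∈ Q.formClosure E) {B : ℝ}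
    (hB : ∀ n, Q.form (u n) ≤ B) {f : Q.domain}
    (hf : Tendsto (fun n => (u n : H)) atTop (𝓝 (f : H))) : f ∈ Q.formClosure E := by
  obtain ⟨g, hg, -, h⟩ := hQ.exists_convexHull hB hf
  obtain rfl : g = f := Subtype.ext hg
  intro ε hε
  obtain ⟨v, hv, hvε⟩ := h (ε / 4) (by positivity)
  have hv' : v ∈ Q.formClosure E :=
    convexHull_min (Set.range_subset_iff.2 hu) (Q.formClosure E).convex hv
  obtain ⟨e, he, heε⟩ := hv' (ε / 4) (by positivity)
  exact ⟨e, he, by linarith [Q.normSq_sub_le_sub_add_sub e v g]⟩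

/-- A closed extension in which the domain of the original form is dense is the closure. -/
theorem isClosureOf_of_dense {C Q : NonnegForm H} (hC : C.IsClosed) (hCQ : C.Extends Q)
    (hd : ∀ f : C.domain, f ∈ C.formClosure Q.domain) : C.IsClosureOf Q := by
  refine ⟨hC, hCQ, fun R hR hRQ => ?_⟩
  obtain ⟨hle, hform⟩ := hCQ
  obtain ⟨hleR, hformR⟩ := hRQ
  have hCR : ∀ e : Q.domain, C.normSq (Submodule.inclusion hle e) =
      R.normSq (Submodule.inclusion hleR e) := fun e => by
    simp [normSq, hform, hformR]
  have key : ∀ f : C.domain, ∃ g : R.domain, (g : H) = f ∧ R.form g = C.form f := by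
    intro f
    have h1 : ∀ n : ℕ, ∃ e : Q.domain,
        C.normSq (Submodule.inclusion hle e - f) < 1 / ((n : ℝ) + 1) := by
      intro n
      obtain ⟨e, he, h⟩ := hd f _ (Nat.one_div_pos_of_nat (α := ℝ) (n := n))
      exact ⟨⟨e, he⟩, h⟩
    choose e he using h1
    have hlim : Tendsto (fun n => C.normSq (Submodule.inclusion hle (e n) - f)) atTop (𝓝 0) :=
      squeeze_zero (fun _ => C.normSq_nonneg _) (fun n => (he n).le)
        tendsto_one_div_add_atTop_nhds_zero_nat
    obtain ⟨g, hg⟩ := hR (fun n => Submodule.inclusion hleR (e n)) (by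
      intro ε hε
      obtain ⟨N, hN⟩ := eventually_atTop.1 (hlim.eventually (gt_mem_nhds
        (show 0 < ε / 4 by positivity)))
      refine ⟨N, fun n k hn hk => ?_⟩
      rw [← map_sub, ← hCR, map_sub]
      have := C.normSq_sub_le_sub_add_sub (Submodule.inclusion hle (e n)) f
        (Submodule.inclusion hle (e k))
      rw [C.normSq_sub_comm f] at this
      linarith [hN n hn, hN k hk])
    have h2 := C.tendsto_coe_of_normSq hlim
    have h3 := R.tendsto_coe_of_normSq hg
    refine ⟨g, tendsto_nhds_unique h3 h2, ?_⟩
    have h4 := C.tendsto_form_of_normSq hlim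
    have h5 := R.tendsto_form_of_normSq hg
    simp only [hform] at h4
    simp only [hformR] at h5
    exact tendsto_nhds_unique h5 h4
  refine ⟨fun f hf => ?_, fun f => ?_⟩
  · obtain ⟨g, hg, -⟩ := key ⟨f, hf⟩
    change (g : H) = f at hg
    exact hg ▸ g.2
  · obtain ⟨g, hg, hg'⟩ := key f
    rw [← hg']
    congr 1
    exact Subtype.ext hg.symm

end GeneralForms

end NonnegForm

/-! ### Lattice operations in the domain of a Dirichlet form -/

namespace NonnegForm

section Lattice

variable {X : Type*} [MeasurableSpace X] {m : Measure X}

/-- Dominated convergence in `L²`. -/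
theorem tendsto_L2_of_dominated {F : ℕ → Lp ℝ 2 m} {f G : Lp ℝ 2 m}
    (hbound : ∀ n, ∀ᵐ x ∂m, |F n x| ≤ |G x|)
    (hlim : ∀ᵐ x ∂m, Tendsto (fun n => F n x) atTop (𝓝 (f x))) :
    Tendsto F atTop (𝓝 f) := by
  have hsq : ∀ g : Lp ℝ 2 m, ‖g‖ ^ 2 = ∫ x, g x ^ 2 ∂m := fun g => by
    rw [← real_inner_self_eq_norm_sq, L2.inner_def]
    exact integral_congr_ae (Eventually.of_forall fun x => by simp [sq])
  have hf : ∀ᵐ x ∂m, |f x| ≤ |G x| := by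
    filter_upwards [hlim, ae_all_iff.2 hbound] with x hx hb
    exact le_of_tendsto' hx.abs hb
  have h1 : Tendsto (fun n => ∫ x, (F n - f) x ^ 2 ∂m) atTop (𝓝 (∫ x : X, (0 : ℝ) ∂m)) := by
    refine tendsto_integral_of_dominated_convergence (fun x => 4 * G x ^ 2)
      (fun n => (Lp.aestronglyMeasurable _).pow 2) ((Lp.memLp G).integrable_sq.const_mul 4) ?_ ?_
    · intro n
      filter_upwards [hf, hbound n, Lp.coeFn_sub (F n) f] with x h1 h2 h3
      rw [h3, Pi.sub_apply, Real.norm_eq_abs, abs_of_nonneg (sq_nonneg _), ← sq_abs (G x)]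
      have h4 : |F n x - f x| ≤ 2 * |G x| := (abs_sub _ _).trans (by linarith)
      rw [← sq_abs (F n x - f x)]
      nlinarith [abs_nonneg (F n x - f x)]
    · filter_upwards [hlim, ae_all_iff.2 fun n => Lp.coeFn_sub (F n) f] with x hx h3
      have : Tendsto (fun n => (F n x - f x) ^ 2) atTop (𝓝 ((f x - f x) ^ 2)) :=
        (hx.sub_const _).pow 2
      rw [sub_self, zero_pow two_ne_zero] at this
      simpa only [h3, Pi.sub_apply] using this
  rw [tendsto_iff_norm_sub_tendsto_zero]
  simp only [← hsq, integral_zero] at h1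
  simpa [Real.sqrt_sq] using h1.sqrt

variable {Q : NonnegForm (Lp ℝ 2 m)}

theorem IsDirichlet.exists_trunc (hQ : Q.IsDirichlet) (f : Q.domain) {c : ℝ} (hc : 0 < c) :
    ∃ g : Q.domain, (∀ᵐ x ∂m, (g : Lp ℝ 2 m) x = min (max ((f : Lp ℝ 2 m) x) 0) c) ∧
      Q.form g ≤ Q.form f := by
  obtain ⟨g, hg, hgf⟩ := hQ.2.2 (c⁻¹ • f)
  refine ⟨c • g, ?_, ?_⟩
  · filter_upwards [hg, Lp.coeFn_smul c (g : Lp ℝ 2 m), Lp.coeFn_smul c⁻¹ (f : Lp ℝ 2 m)]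
      with x h1 h2 h3
    rw [Submodule.coe_smul] at h1 ⊢
    rw [h2, Pi.smul_apply, h1, h3, Pi.smul_apply, smul_eq_mul, smul_eq_mul,
      mul_min_of_nonneg _ _ hc.le, mul_max_of_nonneg _ _ hc.le, mul_inv_cancel_left₀ hc.ne',
      mul_zero, mul_one]
  · rw [form_smul] at hgf ⊢
    calc c ^ 2 * Q.form g ≤ c ^ 2 * (c⁻¹ ^ 2 * Q.form f) := by gcongr
      _ = Q.form f := by field_simp

theorem coeFn_sup_zero (f : Lp ℝ 2 m) : ∀ᵐ x ∂m, (f ⊔ 0 : Lp ℝ 2 m) x = max (f x) 0 := by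
  filter_upwards [Lp.coeFn_sup f 0, Lp.coeFn_zero ℝ 2 m] with x h1 h2
  rw [h1, Pi.sup_apply, h2, Pi.zero_apply]

theorem sub_sub_sup_zero (f g : Lp ℝ 2 m) : f - (f - g) ⊔ 0 = f ⊓ g := by
  rw [Lp.ext_iff]
  filter_upwards [Lp.coeFn_sub f ((f - g) ⊔ 0), coeFn_sup_zero (f - g), Lp.coeFn_sub f g,
    Lp.coeFn_inf f g] with x h1 h2 h3 h4
  rw [h1, h4, Pi.sub_apply, h2, h3, Pi.sub_apply, Pi.inf_apply]
  rcases le_total (f x) (g x) with h | h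
  · rw [max_eq_right (by linarith), inf_eq_left.2 h, sub_zero]
  · rw [max_eq_left (by linarith), inf_eq_right.2 h, sub_sub_cancel]

/-- The truncations at level `c` converge to the positive part as `c → ∞`. -/
theorem tendsto_trunc_atTop {f : Lp ℝ 2 m} {F : ℕ → Lp ℝ 2 m}
    (hF : ∀ n : ℕ, ∀ᵐ x ∂m, F n x = min (max (f x) 0) ((n : ℝ) + 1)) :
    Tendsto F atTop (𝓝 (f ⊔ 0)) := by
  refine tendsto_L2_of_dominated (G := f) (fun n => ?_) ?_
  · filter_upwards [hF n] with x hx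
    rw [hx, abs_of_nonneg (by positivity)]
    exact (min_le_left _ _).trans (max_le (le_abs_self _) (abs_nonneg _))
  · filter_upwards [ae_all_iff.2 hF, coeFn_sup_zero f] with x hx h0
    simp only [hx, h0]
    refine tendsto_const_nhds.congr' ?_
    filter_upwards [eventually_ge_atTop ⌈max (f x) 0⌉₊] with n hn
    rw [min_eq_left]
    exact (Nat.ceil_le.1 hn).trans (by linarith)

/-- The truncations at level `ε` converge to `0` as `ε → 0`. -/
theorem tendsto_trunc_zero {f : Lp ℝ 2 m} {F : ℕ → Lp ℝ 2 m}
    (hF : ∀ n : ℕ, ∀ᵐ x ∂m, F n x = min (max (f x) 0) (1 / ((n : ℝ) + 1))) :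
    Tendsto F atTop (𝓝 0) := by
  refine tendsto_L2_of_dominated (G := f) (fun n => ?_) ?_
  · filter_upwards [hF n] with x hx
    rw [hx, abs_of_nonneg (by positivity)]
    exact (min_le_left _ _).trans (max_le (le_abs_self _) (abs_nonneg _))
  · filter_upwards [ae_all_iff.2 hF, Lp.coeFn_zero ℝ 2 m] with x hx h0
    simp only [hx, h0]
    exact squeeze_zero (fun n => by positivity) (fun n => min_le_right _ _)
      tendsto_one_div_add_atTop_nhds_zero_nat

theorem IsDirichlet.exists_sup_zero (hQ : Q.IsDirichlet) (f : Q.domain) :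
    ∃ g : Q.domain, (g : Lp ℝ 2 m) = (f : Lp ℝ 2 m) ⊔ 0 ∧ Q.form g ≤ Q.form f := by
  choose g hg hgf using fun n : ℕ => hQ.exists_trunc f (Nat.cast_add_one_pos (α := ℝ) n)
  obtain ⟨h, h1, h2, -⟩ := hQ.2.1.exists_convexHull hgf (tendsto_trunc_atTop hg)
  exact ⟨h, h1, h2⟩

theorem IsDirichlet.sup_zero_mem (hQ : Q.IsDirichlet) {f : Lp ℝ 2 m} (hf : f ∈ Q.domain) :
    f ⊔ 0 ∈ Q.domain := by
  obtain ⟨g, hg, -⟩ := hQ.exists_sup_zero ⟨f, hf⟩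
  exact hg ▸ g.2

theorem IsDirichlet.form_sup_zero_le (hQ : Q.IsDirichlet) {f : Lp ℝ 2 m} (hf : f ∈ Q.domain) :
    Q.form ⟨f ⊔ 0, hQ.sup_zero_mem hf⟩ ≤ Q.form ⟨f, hf⟩ := by
  obtain ⟨g, hg, h⟩ := hQ.exists_sup_zero ⟨f, hf⟩
  convert h
  exact hg.symm

theorem norm_sup_zero_le (f : Lp ℝ 2 m) : ‖f ⊔ 0‖ ≤ ‖f‖ := by
  refine Lp.norm_le_norm_of_ae_le ?_
  filter_upwards [coeFn_sup_zero f] with x hx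
  rw [hx, Real.norm_eq_abs, Real.norm_eq_abs, abs_of_nonneg (le_max_right _ _)]
  exact max_le (le_abs_self _) (abs_nonneg _)

theorem IsDirichlet.normSq_sup_zero_le (hQ : Q.IsDirichlet) {f : Lp ℝ 2 m} (hf : f ∈ Q.domain) :
    Q.normSq ⟨f ⊔ 0, hQ.sup_zero_mem hf⟩ ≤ Q.normSq ⟨f, hf⟩ :=
  add_le_add (hQ.form_sup_zero_le hf) (pow_le_pow_left₀ (norm_nonneg _) (norm_sup_zero_le f) 2)

theorem IsDirichlet.inf_mem (hQ : Q.IsDirichlet) {f g : Lp ℝ 2 m} (hf : f ∈ Q.domain)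
    (hg : g ∈ Q.domain) : f ⊓ g ∈ Q.domain := by
  rw [← sub_sub_sup_zero]
  exact Q.domain.sub_mem hf (hQ.sup_zero_mem (Q.domain.sub_mem hf hg))

theorem IsDirichlet.form_inf_le (hQ : Q.IsDirichlet) {f g : Lp ℝ 2 m} (hf : f ∈ Q.domain)
    (hg : g ∈ Q.domain) :
    Q.form ⟨f ⊓ g, hQ.inf_mem hf hg⟩ ≤ 6 * Q.form ⟨f, hf⟩ + 4 * Q.form ⟨g, hg⟩ := by
  have h1 := hQ.form_sup_zero_le (Q.domain.sub_mem hf hg)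
  have h2 := Q.form_sub_le ⟨f, hf⟩ ⟨g, hg⟩
  have h3 := Q.form_sub_le ⟨f, hf⟩ ⟨_, hQ.sup_zero_mem (Q.domain.sub_mem hf hg)⟩
  have h4 : (⟨f ⊓ g, hQ.inf_mem hf hg⟩ : Q.domain) =
      ⟨f, hf⟩ - ⟨_, hQ.sup_zero_mem (Q.domain.sub_mem hf hg)⟩ :=
    Subtype.ext (sub_sub_sup_zero f g).symm
  rw [h4]
  change Q.form ⟨f - g, _⟩ ≤ _ at h2
  linarith

theorem sup_eq_neg_inf_neg (f g : Lp ℝ 2 m) : f ⊔ g = -(-f ⊓ -g) := by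
  rw [neg_inf, neg_neg, neg_neg]

theorem IsDirichlet.sup_mem (hQ : Q.IsDirichlet) {f g : Lp ℝ 2 m} (hf : f ∈ Q.domain)
    (hg : g ∈ Q.domain) : f ⊔ g ∈ Q.domain := by
  rw [sup_eq_neg_inf_neg]
  exact Q.domain.neg_mem (hQ.inf_mem (Q.domain.neg_mem hf) (Q.domain.neg_mem hg))

theorem IsDirichlet.form_sup_le (hQ : Q.IsDirichlet) {f g : Lp ℝ 2 m} (hf : f ∈ Q.domain)
    (hg : g ∈ Q.domain) :
    Q.form ⟨f ⊔ g, hQ.sup_mem hf hg⟩ ≤ 6 * Q.form ⟨f, hf⟩ + 4 * Q.form ⟨g, hg⟩ := by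
  have h1 := hQ.form_inf_le (Q.domain.neg_mem hf) (Q.domain.neg_mem hg)
  have h2 : (⟨f ⊔ g, hQ.sup_mem hf hg⟩ : Q.domain) =
      -⟨-f ⊓ -g, hQ.inf_mem (Q.domain.neg_mem hf) (Q.domain.neg_mem hg)⟩ :=
    Subtype.ext (sup_eq_neg_inf_neg f g)
  rw [h2, form_neg]
  refine h1.trans_eq ?_
  rw [← Q.form_neg ⟨f, hf⟩, ← Q.form_neg ⟨g, hg⟩]
  rfl

end Lattice

end NonnegForm

/-! ### Capacity and polar sets -/

namespace NonnegForm

section Series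

variable {H : Type*} [NormedAddCommGroup H] [InnerProductSpace ℝ H]

theorem normSq_sum_le (Q : NonnegForm H) {a : ℕ → Q.domain} {ε : ℝ} (hε : 0 ≤ ε)
    (ha : ∀ n, Q.normSq (a n) ≤ ε / 4 ^ (n + 1)) (N : ℕ) :
    ∀ M, Q.normSq (∑ i ∈ Finset.range N, a (M + i)) ≤ ε / 4 ^ M := by
  induction N with
  | zero =>
    intro M
    simpa [normSq_zero] using by positivity
  | succ N ih =>
    intro M
    rw [Finset.sum_range_succ']
    have h1 := ih (M + 1)
    have h2 := Q.normSq_add_le (∑ i ∈ Finset.range N, a (M + (i + 1))) (a (M + 0))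
    have h3 : ∀ i, M + 1 + i = M + (i + 1) := fun i => by ring
    simp only [h3] at h1
    have h4 : ε / 4 ^ M = 4 * (ε / 4 ^ (M + 1)) := by
      rw [pow_succ]
      field_simp
    rw [h4]
    have h5 := ha M
    rw [add_zero] at h2 ⊢
    linarith

/-- In a closed form, a series whose terms decay geometrically in the form norm converges. The
ratio `4` makes up for the constants in `‖f + g‖² ≤ 2 ‖f‖² + 2 ‖g‖²`. -/
theorem IsClosed.exists_sum {Q : NonnegForm H} (hQ : Q.IsClosed) {a : ℕ → Q.domain} {ε : ℝ}
    (hε : 0 ≤ ε) (ha : ∀ n, Q.normSq (a n) ≤ ε / 4 ^ (n + 1)) :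
    ∃ f : Q.domain, Q.normSq f ≤ ε ∧
      Tendsto (fun N => ∑ i ∈ Finset.range N, (a i : H)) atTop (𝓝 (f : H)) := by
  have key : ∀ M N, M ≤ N → Q.normSq (∑ i ∈ Finset.range N, a i - ∑ i ∈ Finset.range M, a i) ≤
      ε / 4 ^ M := by
    intro M N h
    obtain ⟨k, rfl⟩ := Nat.exists_eq_add_of_le h
    rw [Finset.sum_range_add, add_sub_cancel_left]
    exact Q.normSq_sum_le hε ha k M
  have hlim : Tendsto (fun M : ℕ => ε / 4 ^ M) atTop (𝓝 0) := by
    simpa [div_eq_mul_inv] using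
      (tendsto_pow_atTop_nhds_zero_of_lt_one (r := (4 : ℝ)⁻¹) (by norm_num) (by norm_num)).const_mul
        ε
  obtain ⟨f, hf⟩ := hQ (fun N => ∑ i ∈ Finset.range N, a i) (by
    intro δ hδ
    obtain ⟨M, hM⟩ := (hlim.eventually (gt_mem_nhds (show 0 < δ / 4 by positivity))).exists
    refine ⟨M, fun n k hn hk => ?_⟩
    have h1 := Q.normSq_sub_le_sub_add_sub (∑ i ∈ Finset.range n, a i)
      (∑ i ∈ Finset.range M, a i) (∑ i ∈ Finset.range k, a i)
    rw [Q.normSq_sub_comm (∑ i ∈ Finset.range M, a i)] at h1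
    linarith [key M n hn, key M k hk])
  have h1 := Q.tendsto_coe_of_normSq hf
  have h2 : Tendsto (fun N => Q.normSq (∑ i ∈ Finset.range N, a i)) atTop (𝓝 (Q.normSq f)) :=
    (Q.tendsto_form_of_normSq hf).add (h1.norm.pow 2)
  refine ⟨f, le_of_tendsto' h2 fun N => ?_, by simpa using h1⟩
  simpa using key 0 N (Nat.zero_le _)

end Series

section Capacity

variable {X : Type*} [MeasurableSpace X] {m : Measure X} {Q : NonnegForm (Lp ℝ 2 m)}

theorem capOpen_le (f : Q.domain) {U : Set X} (hf : ∀ᵐ x ∂m, x ∈ U → 1 ≤ (f : Lp ℝ 2 m) x) :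
    Q.capOpen U ≤ ENNReal.ofReal (Q.normSq f) :=
  iInf₂_le f hf

theorem capOpen_mono {U V : Set X} (h : U ⊆ V) : Q.capOpen U ≤ Q.capOpen V :=
  le_iInf₂ fun f hf => capOpen_le f (hf.mono fun _ hx hxU => hx (h hxU))

theorem capOpen_empty : Q.capOpen ∅ = 0 := by
  have h : Q.capOpen ∅ ≤ ENNReal.ofReal (Q.normSq 0) :=
    capOpen_le 0 (Eventually.of_forall fun x hx => hx.elim)
  simpa [normSq_zero] using h

theorem IsDirichlet.exists_of_capOpen_lt (hQ : Q.IsDirichlet) {U : Set X} {ε : ℝ}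
    (h : Q.capOpen U < ENNReal.ofReal ε) :
    ∃ f : Q.domain, 0 ≤ (f : Lp ℝ 2 m) ∧ (∀ᵐ x ∂m, x ∈ U → 1 ≤ (f : Lp ℝ 2 m) x) ∧
      Q.normSq f < ε := by
  simp only [capOpen, iInf_lt_iff] at h
  obtain ⟨f, hf, h⟩ := h
  refine ⟨⟨(f : Lp ℝ 2 m) ⊔ 0, hQ.sup_zero_mem f.2⟩, le_sup_right, ?_, ?_⟩
  · filter_upwards [hf, coeFn_sup_zero (f : Lp ℝ 2 m)] with x h1 h2 hx
    rw [h2]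
    exact (h1 hx).trans (le_max_left _ _)
  · exact (hQ.normSq_sup_zero_le f.2).trans_lt
      ((ENNReal.ofReal_lt_ofReal_iff_of_nonneg (Q.normSq_nonneg _)).1 h)

theorem IsDirichlet.capOpen_union_le (hQ : Q.IsDirichlet) {U V : Set X} {ε δ : ℝ}
    (hU : Q.capOpen U < ENNReal.ofReal ε) (hV : Q.capOpen V < ENNReal.ofReal δ) :
    Q.capOpen (U ∪ V) ≤ ENNReal.ofReal (2 * ε + 2 * δ) := by
  obtain ⟨f, hf0, hf1, hf⟩ := hQ.exists_of_capOpen_lt hU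
  obtain ⟨g, hg0, hg1, hg⟩ := hQ.exists_of_capOpen_lt hV
  refine (capOpen_le (f + g) ?_).trans (ENNReal.ofReal_le_ofReal ?_)
  · filter_upwards [(Lp.coeFn_nonneg _).2 hf0, (Lp.coeFn_nonneg _).2 hg0, hf1, hg1,
      Lp.coeFn_add (f : Lp ℝ 2 m) g] with x h1 h2 h3 h4 h5 hx
    rw [Submodule.coe_add, h5, Pi.add_apply]
    rw [Pi.zero_apply] at h1 h2
    rcases hx with hx | hx
    · linarith [h3 hx]
    · linarith [h4 hx]
  · linarith [Q.normSq_add_le f g]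

/-- A quantitative form of the countable subadditivity of the capacity. -/
theorem IsDirichlet.capOpen_iUnion_le (hQ : Q.IsDirichlet) {U : ℕ → Set X} {ε : ℝ} (hε : 0 ≤ ε)
    (hU : ∀ n, Q.capOpen (U n) < ENNReal.ofReal (ε / 4 ^ (n + 1))) :
    Q.capOpen (⋃ n, U n) ≤ ENNReal.ofReal ε := by
  choose a ha0 ha1 ha using fun n => hQ.exists_of_capOpen_lt (hU n)
  obtain ⟨f, hf, hlim⟩ := hQ.2.1.exists_sum hε fun n => (ha n).le
  have hle : ∀ n, (a n : Lp ℝ 2 m) ≤ f := fun n => by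
    refine ge_of_tendsto hlim ?_
    filter_upwards [eventually_gt_atTop n] with N hN
    exact Finset.single_le_sum (f := fun i => (a i : Lp ℝ 2 m)) (fun i _ => ha0 i)
      (Finset.mem_range.2 hN)
  refine (capOpen_le f ?_).trans (ENNReal.ofReal_le_ofReal hf)
  filter_upwards [ae_all_iff.2 ha1, ae_all_iff.2 fun n => (Lp.coeFn_le _ _).2 (hle n)]
    with x h1 h2 hx
  obtain ⟨n, hn⟩ := Set.mem_iUnion.1 hx
  exact (h1 n hn).trans (h2 n)

theorem measure_le_capOpen (U : Set X) : m U ≤ Q.capOpen U := by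
  refine le_iInf₂ fun f hf => ?_
  have h1 : m U ≤ m {x | 1 ≤ ‖(f : Lp ℝ 2 m) x‖ₑ} := by
    refine measure_mono_ae ?_
    filter_upwards [hf] with x hx hxU
    change 1 ≤ ‖(f : Lp ℝ 2 m) x‖ₑ
    rw [Real.enorm_eq_ofReal_abs, ← ENNReal.ofReal_one]
    exact ENNReal.ofReal_le_ofReal ((hx hxU).trans (le_abs_self _))
  have h2 := meas_ge_le_mul_pow_eLpNorm_enorm m (p := 2) two_ne_zero ENNReal.ofNat_ne_top
    (Lp.aestronglyMeasurable (f : Lp ℝ 2 m)) (ε := 1) one_ne_zero (by simp)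
  refine (h1.trans h2).trans ?_
  rw [inv_one, ENNReal.one_rpow, one_mul, ← Lp.enorm_def, ← ofReal_norm,
    ENNReal.ofReal_rpow_of_nonneg (norm_nonneg _) (by simp)]
  refine ENNReal.ofReal_le_ofReal ?_
  simpa using Q.sq_norm_le_normSq f

variable [TopologicalSpace X]

theorem cap_mono {A B : Set X} (h : A ⊆ B) : Q.cap A ≤ Q.cap B :=
  le_iInf fun U => le_iInf₂ fun hU hB => iInf_le_of_le U (iInf₂_le hU (h.trans hB))

theorem cap_of_isOpen {U : Set X} (hU : IsOpen U) : Q.cap U = Q.capOpen U :=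
  le_antisymm (iInf_le_of_le U (iInf₂_le hU subset_rfl))
    (le_iInf fun _ => le_iInf₂ fun _ h => capOpen_mono h)

theorem exists_isOpen_of_cap_lt {A : Set X} {ε : ℝ≥0∞} (h : Q.cap A < ε) :
    ∃ U, IsOpen U ∧ A ⊆ U ∧ Q.capOpen U < ε := by
  simpa only [cap, iInf_lt_iff, exists_prop] using h

theorem cap_eq_zero_iff {A : Set X} : Q.cap A = 0 ↔
    ∀ ε : ℝ, 0 < ε → ∃ U, IsOpen U ∧ A ⊆ U ∧ Q.capOpen U < ENNReal.ofReal ε := by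
  refine ⟨fun h ε hε => exists_isOpen_of_cap_lt (by simpa [h] using hε), fun h => ?_⟩
  refine le_antisymm (ENNReal.le_of_forall_pos_le_add fun ε hε _ => ?_) zero_le
  obtain ⟨U, hU, hAU, hlt⟩ := h ε hε
  rw [zero_add, ← ENNReal.ofReal_coe_nnreal]
  exact ((cap_mono hAU).trans (cap_of_isOpen hU).le).trans hlt.le

theorem IsDirichlet.cap_iUnion_eq_zero (hQ : Q.IsDirichlet) {A : ℕ → Set X}
    (hA : ∀ n, Q.cap (A n) = 0) : Q.cap (⋃ n, A n) = 0 := by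
  rw [cap_eq_zero_iff]
  intro ε hε
  choose U hU hAU hlt using fun n => cap_eq_zero_iff.1 (hA n) (ε / 2 / 4 ^ (n + 1)) (by positivity)
  refine ⟨⋃ n, U n, isOpen_iUnion hU, Set.iUnion_mono hAU, ?_⟩
  exact (hQ.capOpen_iUnion_le (by positivity) hlt).trans_lt
    ((ENNReal.ofReal_lt_ofReal_iff hε).2 (by linarith))

theorem IsDirichlet.quasiEverywhere_all (hQ : Q.IsDirichlet) {p : ℕ → X → Prop}
    (hp : ∀ n, Q.QuasiEverywhere (p n)) : Q.QuasiEverywhere fun x => ∀ n, p n x := by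
  have h := hQ.cap_iUnion_eq_zero hp
  rw [QuasiEverywhere]
  convert h using 2
  ext x
  simp

theorem QuasiEverywhere.mono {p q : X → Prop} (hp : Q.QuasiEverywhere p) (h : ∀ x, p x → q x) :
    Q.QuasiEverywhere q :=
  le_antisymm ((cap_mono (show {x | ¬ q x} ⊆ {x | ¬ p x} from fun x hx hpx => hx (h x hpx))).trans
    hp.le) zero_le

theorem IsDirichlet.quasiEverywhere_and (hQ : Q.IsDirichlet) {p q : X → Prop}
    (hp : Q.QuasiEverywhere p) (hq : Q.QuasiEverywhere q) :
    Q.QuasiEverywhere fun x => p x ∧ q x :=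
  (hQ.quasiEverywhere_all (p := fun n => if n = 0 then p else q)
    (fun n => by split_ifs <;> assumption)).mono
    fun _ h => ⟨by simpa using h 0, by simpa using h 1⟩

theorem quasiEverywhere_of_forall {p : X → Prop} (h : ∀ x, p x) : Q.QuasiEverywhere p := by
  have : {x | ¬ p x} = ∅ := by
    ext x
    simp [h]
  rw [QuasiEverywhere, this, cap_of_isOpen isOpen_empty, capOpen_empty]

theorem QuasiEverywhere.ae {p : X → Prop} (hp : Q.QuasiEverywhere p) : ∀ᵐ x ∂m, p x := by
  rw [ae_iff, ← nonpos_iff_eq_zero, ← show Q.cap {x | ¬ p x} = 0 from hp]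
  exact le_iInf fun U => le_iInf₂ fun _ h => (measure_mono h).trans (measure_le_capOpen U)

/-- A polar set is contained in a Borel polar set, so a measure which charges no Borel polar set
ignores all polar sets. -/
theorem ChargesNoPolarSet.ae [BorelSpace X] {O : Set X} {μ : Measure O}
    (hμ : Q.ChargesNoPolarSet μ) {p : X → Prop} (hp : Q.QuasiEverywhere p) :
    ∀ᵐ x : O ∂μ, p x := by
  choose U hU hAU hlt using fun n : ℕ => cap_eq_zero_iff.1 hp (1 / ((n : ℝ) + 1))
    Nat.one_div_pos_of_nat
  have hG : Q.cap (⋂ n, U n) = 0 := by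
    rw [cap_eq_zero_iff]
    intro ε hε
    obtain ⟨n, hn⟩ := exists_nat_one_div_lt hε
    exact ⟨U n, hU n, Set.iInter_subset _ n,
      (hlt n).trans ((ENNReal.ofReal_lt_ofReal_iff hε).2 hn)⟩
  refine measure_mono_null (fun x hx => ?_) (hμ (Subtype.val ⁻¹' ⋂ n, U n)
    (measurable_subtype_coe (MeasurableSet.iInter fun n => (hU n).measurableSet))
    (le_antisymm ((cap_mono (Set.image_preimage_subset _ _)).trans hG.le) zero_le))
  exact Set.mem_iInter.2 fun n => hAU n hx

end Capacity

end NonnegForm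

/-! ### Quasi continuous representatives -/

namespace NonnegForm

section QuasiContinuity

variable {X : Type*} [MeasurableSpace X] [TopologicalSpace X] {m : Measure X}
  {Q : NonnegForm (Lp ℝ 2 m)}

/-- Quasi continuity of a real-valued function. -/
def IsRealQuasiContinuous (Q : NonnegForm (Lp ℝ 2 m)) (h : X → ℝ) : Prop :=
  Measurable h ∧ ∀ ε : ℝ, 0 < ε → ∃ U : Set X, IsOpen U ∧ Q.capOpen U < ENNReal.ofReal ε ∧
    ContinuousOn h Uᶜ

/-- `h` is a real-valued quasi continuous representative of `f`. As a quasi continuous function is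
finite quasi everywhere, nothing is lost by the restriction to real values. -/
def IsRealRep (Q : NonnegForm (Lp ℝ 2 m)) (f : Lp ℝ 2 m) (h : X → ℝ) : Prop :=
  Q.IsRealQuasiContinuous h ∧ ∀ᵐ x ∂m, h x = f x

theorem isRealQuasiContinuous_of_continuous [OpensMeasurableSpace X] {h : X → ℝ}
    (hh : Continuous h) : Q.IsRealQuasiContinuous h :=
  ⟨hh.measurable, fun ε hε => ⟨∅, isOpen_empty, by simpa [capOpen_empty] using hε,
    hh.continuousOn⟩⟩

theorem IsRealQuasiContinuous.comp {h : X → ℝ} (hh : Q.IsRealQuasiContinuous h) {F : ℝ → ℝ}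
    (hF : Continuous F) : Q.IsRealQuasiContinuous fun x => F (h x) := by
  refine ⟨hF.measurable.comp hh.1, fun ε hε => ?_⟩
  obtain ⟨U, hU, hlt, hc⟩ := hh.2 ε hε
  exact ⟨U, hU, hlt, hF.comp_continuousOn hc⟩

theorem IsRealQuasiContinuous.comp₂ (hQ : Q.IsDirichlet) {h k : X → ℝ}
    (hh : Q.IsRealQuasiContinuous h) (hk : Q.IsRealQuasiContinuous k) {F : ℝ × ℝ → ℝ}
    (hF : Continuous F) : Q.IsRealQuasiContinuous fun x => F (h x, k x) := by
  refine ⟨hF.measurable.comp (hh.1.prodMk hk.1), fun ε hε => ?_⟩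
  obtain ⟨U, hU, hUlt, hUc⟩ := hh.2 (ε / 8) (by positivity)
  obtain ⟨V, hV, hVlt, hVc⟩ := hk.2 (ε / 8) (by positivity)
  refine ⟨U ∪ V, hU.union hV, (hQ.capOpen_union_le hUlt hVlt).trans_lt
    ((ENNReal.ofReal_lt_ofReal_iff hε).2 (by linarith)), ?_⟩
  exact hF.comp_continuousOn
    ((hUc.mono (Set.compl_subset_compl.2 Set.subset_union_left)).prodMk
      (hVc.mono (Set.compl_subset_compl.2 Set.subset_union_right)))

theorem IsRealRep.smul {f : Lp ℝ 2 m} {h : X → ℝ} (hh : Q.IsRealRep f h) (c : ℝ) :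
    Q.IsRealRep (c • f) fun x => c * h x := by
  refine ⟨hh.1.comp (continuous_const.mul continuous_id), ?_⟩
  filter_upwards [hh.2, Lp.coeFn_smul c f] with x h1 h2
  rw [h1, h2, Pi.smul_apply, smul_eq_mul]

theorem IsRealRep.add (hQ : Q.IsDirichlet) {f g : Lp ℝ 2 m} {h k : X → ℝ}
    (hh : Q.IsRealRep f h) (hk : Q.IsRealRep g k) :
    Q.IsRealRep (f + g) fun x => h x + k x := by
  refine ⟨hh.1.comp₂ hQ hk.1 (F := fun p => p.1 + p.2) (by fun_prop), ?_⟩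
  filter_upwards [hh.2, hk.2, Lp.coeFn_add f g] with x h1 h2 h3
  rw [h1, h2, h3, Pi.add_apply]

theorem IsRealRep.sub (hQ : Q.IsDirichlet) {f g : Lp ℝ 2 m} {h k : X → ℝ}
    (hh : Q.IsRealRep f h) (hk : Q.IsRealRep g k) :
    Q.IsRealRep (f - g) fun x => h x - k x := by
  refine ⟨hh.1.comp₂ hQ hk.1 (F := fun p => p.1 - p.2) (by fun_prop), ?_⟩
  filter_upwards [hh.2, hk.2, Lp.coeFn_sub f g] with x h1 h2 h3
  rw [h1, h2, h3, Pi.sub_apply]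

theorem IsRealRep.inf (hQ : Q.IsDirichlet) {f g : Lp ℝ 2 m} {h k : X → ℝ}
    (hh : Q.IsRealRep f h) (hk : Q.IsRealRep g k) :
    Q.IsRealRep (f ⊓ g) fun x => min (h x) (k x) := by
  refine ⟨hh.1.comp₂ hQ hk.1 (F := fun p => min p.1 p.2) (by fun_prop), ?_⟩
  filter_upwards [hh.2, hk.2, Lp.coeFn_inf f g] with x h1 h2 h3
  rw [h1, h2, h3, Pi.inf_apply]

theorem IsRealRep.sup_zero {f : Lp ℝ 2 m} {h : X → ℝ} (hh : Q.IsRealRep f h) :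
    Q.IsRealRep (f ⊔ 0) fun x => max (h x) 0 := by
  refine ⟨hh.1.comp (F := fun y => max y 0) (by fun_prop), ?_⟩
  filter_upwards [hh.2, coeFn_sup_zero f] with x h1 h2
  rw [h1, h2]

theorem IsRealRep.trunc {f g : Lp ℝ 2 m} {h : X → ℝ} (hh : Q.IsRealRep f h) {c : ℝ}
    (hg : ∀ᵐ x ∂m, g x = min (max (f x) 0) c) : Q.IsRealRep g fun x => min (max (h x) 0) c := by
  refine ⟨hh.1.comp (F := fun y => min (max y 0) c) (by fun_prop), ?_⟩
  filter_upwards [hh.2, hg] with x h1 h2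
  rw [h1, h2]

/-- Chebyshev's inequality for the capacity. -/
theorem IsDirichlet.exists_isOpen_lt_abs (hQ : Q.IsDirichlet) {f : Q.domain} {h : X → ℝ}
    (hh : Q.IsRealRep f h) {lam δ : ℝ} (hl : 0 < lam) (hδ : 0 < δ) :
    ∃ W, IsOpen W ∧ {x | lam < |h x|} ⊆ W ∧
      Q.capOpen W ≤ ENNReal.ofReal (8 * Q.normSq f / lam ^ 2 + δ) := by
  obtain ⟨U, hU, hUlt, hc⟩ := hh.1.2 (δ / 2) (by positivity)
  obtain ⟨V, hV, hVU⟩ := continuousOn_iff'.1 hc.abs (Set.Ioi lam) isOpen_Ioi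
  obtain ⟨e, he0, he1, he⟩ := hQ.exists_of_capOpen_lt hUlt
  have hsub : {x | lam < |h x|} ∪ U = V ∪ U := by
    ext x
    have := Set.ext_iff.1 hVU x
    by_cases hx : x ∈ U
    · simp [hx]
    · simpa [hx] using this
  refine ⟨V ∪ U, hV.union hU, hsub ▸ Set.subset_union_left, ?_⟩
  rw [← hsub]
  set p : Q.domain := ⟨(f : Lp ℝ 2 m) ⊔ 0, hQ.sup_zero_mem f.2⟩ with hp
  set q : Q.domain := ⟨((-f : Q.domain) : Lp ℝ 2 m) ⊔ 0, hQ.sup_zero_mem (-f : Q.domain).2⟩ with hq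
  refine (capOpen_le (lam⁻¹ • (p + q) + e) ?_).trans (ENNReal.ofReal_le_ofReal ?_)
  · filter_upwards [(Lp.coeFn_nonneg _).2 he0, he1, hh.2, coeFn_sup_zero (f : Lp ℝ 2 m),
      coeFn_sup_zero (-f : Lp ℝ 2 m), Lp.coeFn_neg (f : Lp ℝ 2 m),
      Lp.coeFn_add ((lam⁻¹ • (p + q) : Q.domain) : Lp ℝ 2 m) e,
      Lp.coeFn_smul lam⁻¹ ((p + q : Q.domain) : Lp ℝ 2 m),
      Lp.coeFn_add (p : Lp ℝ 2 m) q] with x h1 h2 h3 h4 h5 h6 h7 h8 h9 hx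
    have h10 : ((p : Lp ℝ 2 m) + q : Lp ℝ 2 m) x = |(f : Lp ℝ 2 m) x| := by
      rw [h9, Pi.add_apply]
      change ((f : Lp ℝ 2 m) ⊔ 0 : Lp ℝ 2 m) x + (-(f : Lp ℝ 2 m) ⊔ 0 : Lp ℝ 2 m) x = _
      rw [h4, h5, h6, Pi.neg_apply]
      rcases le_total 0 ((f : Lp ℝ 2 m) x) with h | h
      · rw [max_eq_left h, max_eq_right (by linarith), abs_of_nonneg h, add_zero]
      · rw [max_eq_right h, max_eq_left (by linarith), abs_of_nonpos h, zero_add]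
    rw [Submodule.coe_add, h7, Pi.add_apply, Submodule.coe_smul]
    rw [Submodule.coe_add] at h8
    rw [Submodule.coe_add, h8, Pi.smul_apply, h10, smul_eq_mul, ← h3]
    rw [Pi.zero_apply] at h1
    rcases hx with hx | hx
    · have : 1 ≤ lam⁻¹ * |h x| := by
        rw [inv_mul_eq_div, one_le_div hl]
        exact (show lam < |h x| from hx).le
      linarith
    · have := h2 hx
      have : 0 ≤ lam⁻¹ * |h x| := by positivity
      linarith
  · have h1 := Q.normSq_add_le (lam⁻¹ • (p + q)) e
    have h2 := Q.normSq_add_le p q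
    have h3 : Q.normSq p ≤ Q.normSq f := hQ.normSq_sup_zero_le f.2
    have h4 : Q.normSq q ≤ Q.normSq f :=
      (hQ.normSq_sup_zero_le (-f : Q.domain).2).trans_eq (Q.normSq_neg f)
    rw [normSq_smul] at h1
    have h5 : lam⁻¹ ^ 2 * Q.normSq (p + q) ≤ lam⁻¹ ^ 2 * (4 * Q.normSq f) :=
      mul_le_mul_of_nonneg_left (by linarith) (by positivity)
    have h6 : 8 * Q.normSq f / lam ^ 2 = 2 * (lam⁻¹ ^ 2 * (4 * Q.normSq f)) := by
      field_simp
      ring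
    rw [h6]
    linarith

theorem IsDirichlet.quasiEverywhere_eq_zero (hQ : Q.IsDirichlet) {h : X → ℝ}
    (hh : Q.IsRealRep 0 h) : Q.QuasiEverywhere fun x => h x = 0 := by
  have h1 : ∀ n : ℕ, Q.QuasiEverywhere fun x => |h x| ≤ 1 / ((n : ℝ) + 1) := by
    intro n
    refine cap_eq_zero_iff.2 fun ε hε => ?_
    obtain ⟨W, hW, hsub, hle⟩ := hQ.exists_isOpen_lt_abs (f := 0) hh
      (Nat.one_div_pos_of_nat (α := ℝ) (n := n)) (half_pos hε)
    refine ⟨W, hW, fun x hx => hsub (not_le.1 hx), hle.trans_lt ?_⟩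
    rw [normSq_zero]
    refine (ENNReal.ofReal_lt_ofReal_iff hε).2 ?_
    simpa using half_lt_self hε
  refine (hQ.quasiEverywhere_all h1).mono fun x hx => abs_eq_zero.1 (le_antisymm ?_ (abs_nonneg _))
  exact ge_of_tendsto' tendsto_one_div_add_atTop_nhds_zero_nat hx

/-- Quasi continuous representatives are unique up to equality quasi everywhere. -/
theorem IsRealRep.eq (hQ : Q.IsDirichlet) {f : Lp ℝ 2 m} {h k : X → ℝ} (hh : Q.IsRealRep f h)
    (hk : Q.IsRealRep f k) : Q.QuasiEverywhere fun x => h x = k x := by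
  have h1 := hh.sub hQ hk
  rw [sub_self] at h1
  exact (hQ.quasiEverywhere_eq_zero h1).mono fun x => sub_eq_zero.1

/-- A Borel–Cantelli argument: quasi continuous functions whose form norms decay fast tend to zero
geometrically fast, uniformly off open sets of arbitrarily small capacity. -/
theorem IsDirichlet.exists_isOpen_abs_le (hQ : Q.IsDirichlet) {f : ℕ → Q.domain} {h : ℕ → X → ℝ}
    (hh : ∀ n, Q.IsRealRep (f n) (h n)) (hf : ∀ n, Q.normSq (f n) ≤ (1 / 32) ^ n) {ε : ℝ}
    (hε : 0 < ε) : ∃ V, IsOpen V ∧ Q.capOpen V < ENNReal.ofReal ε ∧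
      ∃ k, ∀ x ∉ V, ∀ n, k ≤ n → |h n x| ≤ (1 / 2) ^ n := by
  -- Chebyshev's inequality at level `2⁻ⁿ` costs a factor `4ⁿ`, so `W n` has capacity `≲ 8⁻ⁿ`; a
  -- further factor `4ⁿ` is absorbed by the subadditivity estimate for `⋃ n, W (k + n)`
  choose W hW hsub hle using fun n => hQ.exists_isOpen_lt_abs (hh n)
    (show (0 : ℝ) < (1 / 2) ^ n by positivity) (show (0 : ℝ) < (1 / 8) ^ n by positivity)
  have hlim : Tendsto (fun k : ℕ => 40 * (1 / 8 : ℝ) ^ k) atTop (𝓝 0) := by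
    simpa using (tendsto_pow_atTop_nhds_zero_of_lt_one (r := (1 / 8 : ℝ)) (by norm_num)
      (by norm_num)).const_mul 40
  obtain ⟨k, hk⟩ := (hlim.eventually (gt_mem_nhds hε)).exists
  refine ⟨⋃ n, W (k + n), isOpen_iUnion fun n => hW _, ?_, k, fun x hx n hn => ?_⟩
  · refine (hQ.capOpen_iUnion_le (ε := 40 * (1 / 8) ^ k) (by positivity) fun n => ?_).trans_lt
      ((ENNReal.ofReal_lt_ofReal_iff hε).2 hk)
    refine (hle (k + n)).trans_lt ((ENNReal.ofReal_lt_ofReal_iff (by positivity)).2 ?_)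
    have h1 : 8 * Q.normSq (f (k + n)) / ((1 / 2) ^ (k + n)) ^ 2 ≤ 8 * (1 / 8) ^ (k + n) := by
      rw [div_le_iff₀ (by positivity), ← pow_mul, mul_comm (k + n) 2, pow_mul, mul_assoc, ← mul_pow]
      norm_num
      simpa using hf (k + n)
    have h2 : (1 / 8 : ℝ) ^ n ≤ (1 / 4) ^ n := pow_le_pow_left₀ (by norm_num) (by norm_num) n
    calc 8 * Q.normSq (f (k + n)) / ((1 / 2) ^ (k + n)) ^ 2 + (1 / 8) ^ (k + n)
        ≤ 9 * (1 / 8) ^ (k + n) := by linarith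
      _ = 9 * (1 / 8) ^ k * (1 / 8) ^ n := by ring
      _ ≤ 9 * (1 / 8) ^ k * (1 / 4) ^ n := by gcongr
      _ < 10 * (1 / 8) ^ k * (1 / 4) ^ n := by gcongr; norm_num
      _ = 40 * (1 / 8) ^ k / 4 ^ (n + 1) := by
        rw [pow_succ, one_div_pow 4 n]
        field_simp
        ring
  · by_contra hlt
    refine hx (Set.mem_iUnion.2 ⟨n - k, ?_⟩)
    rw [Nat.add_sub_cancel' hn]
    exact hsub n (not_le.1 hlt)

theorem IsDirichlet.quasiEverywhere_tendsto_zero (hQ : Q.IsDirichlet) {f : ℕ → Q.domain}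
    {h : ℕ → X → ℝ} (hh : ∀ n, Q.IsRealRep (f n) (h n))
    (hf : ∀ n, Q.normSq (f n) ≤ (1 / 32) ^ n) :
    Q.QuasiEverywhere fun x => Tendsto (fun n => h n x) atTop (𝓝 0) := by
  refine cap_eq_zero_iff.2 fun ε hε => ?_
  obtain ⟨V, hV, hlt, k, hk⟩ := hQ.exists_isOpen_abs_le hh hf hε
  refine ⟨V, hV, fun x hx => ?_, hlt⟩
  by_contra hxV
  refine hx (squeeze_zero_norm' ?_
    (tendsto_pow_atTop_nhds_zero_of_lt_one (r := (1 / 2 : ℝ)) (by norm_num) (by norm_num)))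
  filter_upwards [eventually_ge_atTop k] with n hn using hk x hxV n hn

end QuasiContinuity

section Existence

variable {X : Type*} [TopologicalSpace X] [MeasurableSpace X] [BorelSpace X] {m : Measure X}
  [IsFiniteMeasureOnCompacts m] {Q : NonnegForm (Lp ℝ 2 m)}

theorem coeFn_toL2 (φ : C_c(X, ℝ)) : ∀ᵐ x ∂m, toL2 m φ x = φ x :=
  (φ.continuous.memLp_of_hasCompactSupport φ.hasCompactSupport).coeFn_toLp

theorem isRealRep_toL2 (φ : C_c(X, ℝ)) : Q.IsRealRep (toL2 m φ) φ := by
  refine ⟨isRealQuasiContinuous_of_continuous φ.continuous, ?_⟩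
  filter_upwards [coeFn_toL2 (m := m) φ] with x hx using hx.symm

/-- Every function in the domain of a regular Dirichlet form has a quasi continuous representative,
the limit of a fast converging sequence of functions in `D(Q) ∩ C_c(X)`. -/
theorem IsRegular.exists_isRealRep (hreg : Q.IsRegular) (hQ : Q.IsDirichlet) (f : Q.domain) :
    ∃ h, Q.IsRealRep f h := by
  choose ψ hψ hψf using fun n : ℕ => hreg.2 f (1 / 4 * (1 / 32) ^ n) (by positivity)
  set u : ℕ → Q.domain := fun n => ⟨toL2 m (ψ n), hψ n⟩ with hu
  have hd : ∀ n, Q.normSq (u (n + 1) - u n) ≤ (1 / 32) ^ n := by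
    intro n
    have h1 := Q.normSq_sub_le_sub_add_sub (u (n + 1)) f (u n)
    rw [Q.normSq_sub_comm (u (n + 1)) f] at h1
    have h2 := hψf n
    have h3 := hψf (n + 1)
    rw [pow_succ] at h3
    have h4 : (0 : ℝ) ≤ (1 / 32) ^ n := by positivity
    change Q.normSq (f - u n) < _ at h2
    change Q.normSq (f - u (n + 1)) < _ at h3
    linarith
  have hrep : ∀ n, Q.IsRealRep ((u (n + 1) - u n : Q.domain) : Lp ℝ 2 m)
      (fun x => ψ (n + 1) x - ψ n x) := fun n => (isRealRep_toL2 _).sub hQ (isRealRep_toL2 _)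
  -- the limit superior is measurable everywhere, and it is the limit where that exists
  set h : X → ℝ := fun x => (limsup (fun n => ((ψ n x : ℝ) : EReal)) atTop).toReal with hh
  have hmeas : Measurable h :=
    (Measurable.limsup fun n => (ψ n).continuous.measurable.coe_real_ereal).ereal_toReal
  -- the rate of convergence off an exceptional set
  have key : ∀ (V : Set X) (k : ℕ),
      (∀ x ∉ V, ∀ n, k ≤ n → |ψ (n + 1) x - ψ n x| ≤ (1 / 2) ^ n) →
      ∀ x ∉ V, ∀ n, dist (ψ (k + n) x) (h x) ≤ 2 * (1 / 2) ^ k / 2 ^ n := by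
    intro V k hV x hx
    have h1 : ∀ n, dist (ψ (k + n) x) (ψ (k + (n + 1)) x) ≤ 2 * (1 / 2) ^ k / 2 / 2 ^ n := by
      intro n
      rw [dist_comm, Real.dist_eq]
      refine (hV x hx (k + n) (Nat.le_add_right _ _)).trans_eq ?_
      rw [pow_add, one_div_pow 2 n]
      ring
    obtain ⟨l, hl⟩ := cauchySeq_tendsto_of_complete (cauchySeq_of_le_geometric_two h1)
    have hl' : Tendsto (fun n => ψ n x) atTop (𝓝 l) :=
      (tendsto_add_atTop_iff_nat k).1 (by simpa only [add_comm k] using hl)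
    have h2 : h x = l := by
      have h3 : limsup (fun n => ((ψ n x : ℝ) : EReal)) atTop = (l : EReal) :=
        (continuous_coe_real_ereal.continuousAt.tendsto.comp hl').limsup_eq
      rw [hh]
      dsimp only
      rw [h3, EReal.toReal_coe]
    rw [h2]
    exact fun n => dist_le_of_le_geometric_two_of_tendsto h1 hl n
  have hrate : ∀ k : ℕ, Tendsto (fun n : ℕ => 2 * (1 / 2 : ℝ) ^ k / 2 ^ n) atTop (𝓝 0) := by
    intro k
    simpa [div_eq_mul_inv] using (tendsto_pow_atTop_nhds_zero_of_lt_one (r := (2 : ℝ)⁻¹)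
      (by norm_num) (by norm_num)).const_mul (2 * (1 / 2 : ℝ) ^ k)
  have hqe : Q.QuasiEverywhere fun x => Tendsto (fun n => ψ n x) atTop (𝓝 (h x)) := by
    refine cap_eq_zero_iff.2 fun ε hε => ?_
    obtain ⟨V, hV, hlt, k, hk⟩ := hQ.exists_isOpen_abs_le hrep hd hε
    refine ⟨V, hV, fun x hx => ?_, hlt⟩
    by_contra hxV
    refine hx ((tendsto_add_atTop_iff_nat k).1 ?_)
    rw [tendsto_iff_dist_tendsto_zero]
    simp only [add_comm _ k]
    exact squeeze_zero (fun _ => dist_nonneg) (key V k hk x hxV) (hrate k)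
  refine ⟨h, ⟨hmeas, fun ε hε => ?_⟩, ?_⟩
  · obtain ⟨V, hV, hlt, k, hk⟩ := hQ.exists_isOpen_abs_le hrep hd hε
    refine ⟨V, hV, hlt, ?_⟩
    have hunif : TendstoUniformlyOn (fun n => ⇑(ψ (k + n))) h atTop Vᶜ := by
      rw [Metric.tendstoUniformlyOn_iff]
      intro δ hδ
      filter_upwards [(hrate k).eventually (gt_mem_nhds hδ)] with n hn x hx
      rw [dist_comm]
      exact (key V k hk x hx n).trans_lt hn
    exact hunif.continuousOn (Frequently.of_forall fun n => (ψ (k + n)).continuous.continuousOn)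
  · have hlim : Tendsto (fun n => Q.normSq (u n - f)) atTop (𝓝 0) := by
      refine squeeze_zero (fun _ => Q.normSq_nonneg _)
        (g := fun n => 1 / 4 * (1 / 32 : ℝ) ^ n) (fun n => ?_) ?_
      · rw [normSq_sub_comm]
        exact (hψf n).le
      · simpa only [mul_zero] using (tendsto_pow_atTop_nhds_zero_of_lt_one (r := (1 / 32 : ℝ))
          (by norm_num) (by norm_num)).const_mul (1 / 4 : ℝ)
    obtain ⟨ns, hns, hae⟩ :=
      (tendstoInMeasure_of_tendsto_Lp (Q.tendsto_coe_of_normSq hlim)).exists_seq_tendsto_ae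
    filter_upwards [hae, hqe.ae, ae_all_iff.2 fun n => coeFn_toL2 (m := m) (ψ n)] with x h1 h2 h3
    refine tendsto_nhds_unique (h2.comp hns.tendsto_atTop) ?_
    simpa only [Function.comp_def, hu, h3] using h1

end Existence

section ExtendedReal

variable {X : Type*} [MeasurableSpace X] [TopologicalSpace X] {m : Measure X}
  {Q : NonnegForm (Lp ℝ 2 m)}

theorem IsRealRep.coe_ereal {f : Lp ℝ 2 m} {h : X → ℝ} (hh : Q.IsRealRep f h) :
    Q.IsQuasiContinuousRep f fun x => (h x : EReal) := by
  refine ⟨⟨hh.1.1.coe_real_ereal, fun ε hε => ?_⟩, hh.2.mono fun x hx => congrArg Real.toEReal hx⟩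
  obtain ⟨δ, hδ0, hδ⟩ : ∃ δ : ℝ, 0 < δ ∧ ENNReal.ofReal δ ≤ ε := by
    obtain ⟨δ, hδ0, hδ⟩ := ENNReal.lt_iff_exists_nnreal_btwn.1 hε
    exact ⟨δ, by exact_mod_cast hδ0, by rw [ENNReal.ofReal_coe_nnreal]; exact hδ.le⟩
  obtain ⟨U, hU, hlt, hc⟩ := hh.1.2 δ hδ0
  exact ⟨U, hU, (cap_of_isOpen hU).trans_lt (hlt.trans_le hδ),
    fun x _ => ⟨EReal.coe_ne_bot _, EReal.coe_ne_top _⟩,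
    continuous_coe_real_ereal.comp_continuousOn hc⟩

theorem IsQuasiContinuousRep.isRealRep {f : Lp ℝ 2 m} {g : X → EReal}
    (hg : Q.IsQuasiContinuousRep f g) : Q.IsRealRep f fun x => (g x).toReal := by
  refine ⟨⟨hg.1.1.ereal_toReal, fun ε hε => ?_⟩, hg.2.mono fun x hx => congrArg EReal.toReal hx⟩
  obtain ⟨U, hU, hlt, hfin, hc⟩ := hg.1.2 (ENNReal.ofReal ε) (by simpa using hε)
  refine ⟨U, hU, (cap_of_isOpen hU).symm.trans_lt hlt, ?_⟩
  refine EReal.continuousOn_toReal.comp hc fun x hx => ?_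
  simpa using hfin x hx

theorem IsQuasiContinuousRep.coe_toReal {f : Lp ℝ 2 m} {g : X → EReal}
    (hg : Q.IsQuasiContinuousRep f g) : Q.QuasiEverywhere fun x => ((g x).toReal : EReal) = g x := by
  refine cap_eq_zero_iff.2 fun ε hε => ?_
  obtain ⟨U, hU, hlt, hfin, -⟩ := hg.1.2 (ENNReal.ofReal ε) (by simpa using hε)
  refine ⟨U, hU, fun x hx => ?_, (cap_of_isOpen hU).symm.trans_lt hlt⟩
  by_contra hxU
  exact hx (EReal.coe_toReal (hfin x hxU).2 (hfin x hxU).1)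

end ExtendedReal

end NonnegForm

/-! ### Cutoff functions and the necessity of charging no polar set -/

namespace NonnegForm

section CompactSupport

theorem tsupport_sup_zero_inf_subset {X : Type*} [TopologicalSpace X] (φ : C_c(X, ℝ))
    {χ : C_c(X, ℝ)} :
    tsupport ((φ ⊔ 0) ⊓ χ : C_c(X, ℝ)) ⊆ tsupport χ := by
  refine closure_mono fun x hx hχ => hx ?_
  simp [hχ]

variable {X : Type*} [TopologicalSpace X] [MeasurableSpace X] [BorelSpace X] {m : Measure X}
  [IsFiniteMeasureOnCompacts m] {Q : NonnegForm (Lp ℝ 2 m)}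

theorem toL2_inf (φ ψ : C_c(X, ℝ)) : toL2 m (φ ⊓ ψ) = toL2 m φ ⊓ toL2 m ψ := by
  rw [Lp.ext_iff]
  filter_upwards [coeFn_toL2 (m := m) (φ ⊓ ψ), coeFn_toL2 (m := m) φ, coeFn_toL2 (m := m) ψ,
    Lp.coeFn_inf (toL2 m φ) (toL2 m ψ)] with x h1 h2 h3 h4
  rw [h1, h4, Pi.inf_apply, h2, h3, CompactlySupportedContinuousMap.inf_apply]

theorem toL2_sup (φ ψ : C_c(X, ℝ)) : toL2 m (φ ⊔ ψ) = toL2 m φ ⊔ toL2 m ψ := by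
  rw [Lp.ext_iff]
  filter_upwards [coeFn_toL2 (m := m) (φ ⊔ ψ), coeFn_toL2 (m := m) φ, coeFn_toL2 (m := m) ψ,
    Lp.coeFn_sup (toL2 m φ) (toL2 m ψ)] with x h1 h2 h3 h4
  rw [h1, h4, Pi.sup_apply, h2, h3, CompactlySupportedContinuousMap.sup_apply]

theorem toL2_sup_zero (φ : C_c(X, ℝ)) : toL2 m (φ ⊔ 0) = toL2 m φ ⊔ 0 := by
  rw [toL2_sup, map_zero]

/-- A regular Dirichlet form has cutoff functions in its domain. -/
theorem IsRegular.exists_cutoff [T2Space X] [LocallyCompactSpace X] (hreg : Q.IsRegular)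
    (hQ : Q.IsDirichlet) {K O : Set X} (hK : IsCompact K) (hO : IsOpen O) (hKO : K ⊆ O) :
    ∃ χ : C_c(X, ℝ), toL2 m χ ∈ Q.domain ∧ tsupport χ ⊆ O ∧ (∀ x, 0 ≤ χ x) ∧ (∀ x, χ x ≤ 1) ∧
      ∀ x ∈ K, χ x = 1 := by
  obtain ⟨φ, hφ1, hφc, hφO, hφ⟩ := exists_continuousMap_one_of_isCompact_subset_isOpen hK hO hKO
  set Φ : C_c(X, ℝ) := ⟨φ, hφc⟩
  obtain ⟨ψ, hψ, hψφ⟩ := hreg.1 ((3 : ℝ) • Φ) 1 one_pos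
  have hψφ' : ∀ x, |3 * φ x - ψ x| < 1 := hψφ
  -- `(ψ₊ ∧ 2) - (ψ₊ ∧ 1) = (ψ - 1)₊ ∧ 1` vanishes where `φ` does, and is `1` where `φ` is
  have hsupp : Function.support (fun x => min (max (ψ x) 0) 2 - min (max (ψ x) 0) 1) ⊆
      Function.support φ := by
    intro x hx h0
    have h1 := hψφ' x
    rw [h0, mul_zero, zero_sub, abs_neg] at h1
    have h2 : max (ψ x) 0 ≤ 1 := max_le (abs_lt.1 h1).2.le zero_le_one
    refine hx ?_
    change min (max (ψ x) 0) 2 - min (max (ψ x) 0) 1 = 0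
    rw [min_eq_left h2, min_eq_left (h2.trans one_le_two), sub_self]
  let χ : C_c(X, ℝ) :=
    ⟨⟨fun x => min (max (ψ x) 0) 2 - min (max (ψ x) 0) 1, by
      have := ψ.continuous
      fun_prop⟩, hφc.of_isClosed_subset (isClosed_tsupport _) (closure_mono hsupp)⟩
  have hχ : ∀ x, χ x = min (max (ψ x) 0) 2 - min (max (ψ x) 0) 1 := fun x => rfl
  refine ⟨χ, ?_, (closure_mono hsupp).trans hφO, fun x => ?_, fun x => ?_, fun x hx => ?_⟩
  · obtain ⟨a, ha, -⟩ := hQ.exists_trunc ⟨_, hψ⟩ (c := 2) two_pos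
    obtain ⟨b, hb, -⟩ := hQ.exists_trunc ⟨_, hψ⟩ (c := 1) one_pos
    have : toL2 m χ = ((a - b : Q.domain) : Lp ℝ 2 m) := by
      rw [Lp.ext_iff]
      filter_upwards [ha, hb, coeFn_toL2 (m := m) χ, coeFn_toL2 (m := m) ψ,
        Lp.coeFn_sub (a : Lp ℝ 2 m) b] with x h1 h2 h3 h4 h5
      rw [Submodule.coe_sub, h5, Pi.sub_apply, h1, h2, h3, h4, hχ]
    rw [this]
    exact (a - b).2
  · rw [hχ, sub_nonneg]
    exact min_le_min_left _ one_le_two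
  · rw [hχ]
    rcases le_total (max (ψ x) 0) 1 with h | h
    · rw [min_eq_left h, min_eq_left (h.trans one_le_two)]
      linarith
    · rw [min_eq_right h]
      linarith [min_le_right (max (ψ x) 0) 2]
  · have h1 := hψφ' x
    rw [show φ x = 1 from hφ1 hx] at h1
    have h2 : 2 ≤ max (ψ x) 0 := le_max_of_le_left (by linarith [(abs_lt.1 h1).2])
    rw [hχ, min_eq_right h2, min_eq_right (one_le_two.trans h2)]
    norm_num

theorem IsRegular.exists_seq (hreg : Q.IsRegular) (f : Q.domain) :
    ∃ (ψ : ℕ → C_c(X, ℝ)) (hψ : ∀ n, toL2 m (ψ n) ∈ Q.domain) (B : ℝ),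
      Tendsto (fun n => toL2 m (ψ n)) atTop (𝓝 (f : Lp ℝ 2 m)) ∧
      ∀ n, Q.form ⟨toL2 m (ψ n), hψ n⟩ ≤ B := by
  choose ψ hψ hψf using fun n : ℕ => hreg.2 f _ (Nat.one_div_pos_of_nat (α := ℝ) (n := n))
  have hlim : Tendsto (fun n => Q.normSq (⟨toL2 m (ψ n), hψ n⟩ - f)) atTop (𝓝 0) := by
    refine squeeze_zero (fun _ => Q.normSq_nonneg _) (fun n => ?_)
      tendsto_one_div_add_atTop_nhds_zero_nat
    rw [normSq_sub_comm]
    exact (hψf n).le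
  obtain ⟨B, hB⟩ := (Q.tendsto_form_of_normSq hlim).bddAbove_range
  exact ⟨ψ, hψ, B, Q.tendsto_coe_of_normSq hlim, fun n => hB ⟨n, rfl⟩⟩

/-- The capacity of a compact set can be computed, up to a constant, with functions in
`D(Q) ∩ C_c(X)`. With `e ≥ 1` on `U` and a cutoff function `χ ≤ 1` supported in `U`, the functions
`ψ ⊔ χ` for `ψ ∈ D(Q) ∩ C_c(X)` close to `e` are at least `1` on `K` and close to `e ⊔ χ = e`. -/
theorem IsRegular.exists_one_le [T2Space X] [LocallyCompactSpace X] (hreg : Q.IsRegular)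
    (hQ : Q.IsDirichlet) {K U : Set X} (hK : IsCompact K) (hU : IsOpen U) (hKU : K ⊆ U) {ε : ℝ}
    (hε : 0 < ε) (hcap : Q.capOpen U < ENNReal.ofReal ε) :
    ∃ (v : C_c(X, ℝ)) (hv : toL2 m v ∈ Q.domain), (∀ x ∈ K, 1 ≤ v x) ∧
      Q.normSq ⟨toL2 m v, hv⟩ < 4 * ε := by
  obtain ⟨e, he0, he1, he⟩ := hQ.exists_of_capOpen_lt hcap
  obtain ⟨χ, hχ, hχU, hχ0, hχ1, hχK⟩ := hreg.exists_cutoff hQ hK hU hKU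
  obtain ⟨ψ, hψ, B, hlim, hB⟩ := hreg.exists_seq e
  have hsup : (e : Lp ℝ 2 m) ⊔ toL2 m χ = e := by
    rw [sup_eq_left, ← Lp.coeFn_le]
    filter_upwards [he1, coeFn_toL2 (m := m) χ, (Lp.coeFn_nonneg _).2 he0] with x h1 h2 h3
    rw [h2]
    by_cases hx : x ∈ U
    · exact (hχ1 x).trans (h1 hx)
    · rw [image_eq_zero_of_notMem_tsupport (fun h => hx (hχU h))]
      exact h3
  obtain ⟨f, hf, -, hv⟩ := hQ.2.1.exists_convexHull
    (u := fun n => ⟨toL2 m (ψ n) ⊔ toL2 m χ, hQ.sup_mem (hψ n) hχ⟩)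
    (B := 6 * B + 4 * Q.form ⟨toL2 m χ, hχ⟩) (y := e)
    (fun n => (hQ.form_sup_le (hψ n) hχ).trans (by linarith [hB n]))
    (by simpa only [hsup] using hlim.sup_nhds (tendsto_const_nhds (x := toL2 m χ)))
  obtain rfl : f = e := Subtype.ext hf
  obtain ⟨v, hv, hvε⟩ := hv ε hε
  have hconv : Convex ℝ {w : Q.domain | ∃ φ : C_c(X, ℝ), toL2 m φ = w ∧ ∀ x ∈ K, 1 ≤ φ x} := by
    rintro w ⟨φ, hφ, hφ1⟩ w' ⟨φ', hφ', hφ1'⟩ a b ha hb hab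
    refine ⟨a • φ + b • φ', by simp [hφ, hφ'], fun x hx => ?_⟩
    have h1 := mul_le_mul_of_nonneg_left (hφ1 x hx) ha
    have h2 := mul_le_mul_of_nonneg_left (hφ1' x hx) hb
    change 1 ≤ a * φ x + b * φ' x
    linarith
  have hsub : convexHull ℝ (Set.range fun n => (⟨toL2 m (ψ n) ⊔ toL2 m χ,
      hQ.sup_mem (hψ n) hχ⟩ : Q.domain)) ⊆
      {w : Q.domain | ∃ φ : C_c(X, ℝ), toL2 m φ = w ∧ ∀ x ∈ K, 1 ≤ φ x} := by
    refine convexHull_min ?_ hconv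
    rintro _ ⟨n, rfl⟩
    exact ⟨ψ n ⊔ χ, toL2_sup _ _, fun x hx => (hχK x hx).ge.trans le_sup_right⟩
  obtain ⟨φ, hφ, hφ1⟩ := hsub hv
  refine ⟨φ, hφ ▸ v.2, hφ1, ?_⟩
  have h1 : (⟨toL2 m φ, hφ ▸ v.2⟩ : Q.domain) = v - f + f := by
    rw [sub_add_cancel]
    exact Subtype.ext hφ
  rw [h1]
  linarith [Q.normSq_add_le (v - f) f]

theorem addMeasure_form_of_eq [m.IsOpenPosMeasure] {O : Set X} {μ : Measure O}
    [IsFiniteMeasureOnCompacts μ]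
    {φ : C_c(X, ℝ)} (hφ : tsupport φ ⊆ O) {f : Lp ℝ 2 m} (hf : toL2 m φ = f)
    (hfA : f ∈ (Q.addMeasure μ).domain) :
    (Q.addMeasure μ).form ⟨f, hfA⟩ = Q.form ⟨f, hfA.1⟩ + ∫ x : O, φ x ^ 2 ∂μ := by
  subst hf
  exact addMeasure_form Q μ φ hφ hfA

end CompactSupport

section Closable

variable {X : Type*} [MetricSpace X] [LocallyCompactSpace X] [MeasurableSpace X] [BorelSpace X]
  {m : Measure X} [IsFiniteMeasureOnCompacts m] [m.IsOpenPosMeasure]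
  {Q : NonnegForm (Lp ℝ 2 m)}

/-- If the form is closable, a compact set of capacity zero is a null set: it carries functions
`φ ≥ 1` in `D(Q) ∩ C_c(O)` which tend to zero in `L²(X, m)` and have bounded energies. -/
theorem measure_eq_zero_of_isClosable (hQ : Q.IsDirichlet) (hreg : Q.IsRegular) {O : Set X}
    (hO : IsOpen O) {μ : Measure O} [IsFiniteMeasureOnCompacts μ]
    (hcl : (Q.addMeasure μ).IsClosable) {K : Set O} (hK : IsCompact K)
    (hcap : Q.cap (Subtype.val '' K) = 0) : μ K = 0 := by
  obtain ⟨R, hR, hle, hform⟩ := hcl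
  have hK' : IsCompact (Subtype.val '' K) := hK.image continuous_subtype_val
  have hKO : Subtype.val '' K ⊆ O := by
    rintro _ ⟨x, -, rfl⟩
    exact x.2
  obtain ⟨χ, hχ, hχO, hχ0, hχ1, hχK⟩ := hreg.exists_cutoff hQ hK' hO hKO
  have hv : ∀ n : ℕ, ∃ (v : C_c(X, ℝ)) (hv : toL2 m v ∈ Q.domain),
      (∀ x ∈ Subtype.val '' K, 1 ≤ v x) ∧ Q.normSq ⟨toL2 m v, hv⟩ < 4 * (1 / ((n : ℝ) + 1)) := by
    intro n
    obtain ⟨U, hU, hKU, hlt⟩ := cap_eq_zero_iff.1 hcap _ (Nat.one_div_pos_of_nat (α := ℝ) (n := n))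
    exact hreg.exists_one_le hQ hK' hU hKU Nat.one_div_pos_of_nat hlt
  choose v hv hv1 hvn using hv
  have hlim0 : Tendsto (fun n => Q.normSq (⟨toL2 m (v n), hv n⟩ - 0)) atTop (𝓝 0) := by
    refine squeeze_zero (fun _ => Q.normSq_nonneg _) (fun n => ?_)
      (by simpa only [mul_zero] using
        (tendsto_one_div_add_atTop_nhds_zero_nat (𝕜 := ℝ)).const_mul (4 : ℝ))
    rw [sub_zero]
    exact (hvn n).le
  have hlim := Q.tendsto_coe_of_normSq hlim0
  obtain ⟨B, hB⟩ := (Q.tendsto_form_of_normSq hlim0).bddAbove_range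
  set φ : ℕ → C_c(X, ℝ) := fun n => (v n ⊔ 0) ⊓ χ with hφ
  have hφO : ∀ n, tsupport (φ n) ⊆ O := fun n => (tsupport_sup_zero_inf_subset _).trans hχO
  have hφL : ∀ n, toL2 m (φ n) = (toL2 m (v n) ⊔ 0) ⊓ toL2 m χ := fun n => by
    rw [toL2_inf, toL2_sup_zero]
  have hφQ : ∀ n, toL2 m (φ n) ∈ Q.domain := fun n =>
    hφL n ▸ hQ.inf_mem (hQ.sup_zero_mem (hv n)) hχ
  have hφA : ∀ n, toL2 m (φ n) ∈ (Q.addMeasure μ).domain := fun n =>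
    (mem_addMeasure_domain Q μ _).2 ⟨hφQ n, φ n, hφO n, rfl⟩
  have hsq : ∀ ψ : C_c(X, ℝ), tsupport ψ ⊆ O → Integrable (fun x : O => ψ x ^ 2) μ := fun ψ hψ => by
    simpa only [sq] using integrable_mul_ccOn μ ⟨ψ, hψ⟩ ⟨ψ, hψ⟩
  have hφB : ∀ n, Q.form ⟨toL2 m (φ n), hφQ n⟩ ≤ 6 * B + 4 * Q.form ⟨toL2 m χ, hχ⟩ := by
    intro n
    have h1 := hQ.form_inf_le (hQ.sup_zero_mem (hv n)) hχ
    have h2 := hQ.form_sup_zero_le (hv n)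
    have h3 : Q.form ⟨toL2 m (v n), hv n⟩ ≤ B := hB ⟨n, rfl⟩
    simp only [hφL]
    linarith
  have hlimφ : Tendsto (fun n => toL2 m (φ n)) atTop (𝓝 0) := by
    have h0 : (0 : Lp ℝ 2 m) ⊓ toL2 m χ = 0 := by
      rw [inf_eq_left, ← Lp.coeFn_nonneg]
      filter_upwards [coeFn_toL2 (m := m) χ] with x hx
      rw [hx]
      exact hχ0 x
    have := (hlim.sup_nhds (tendsto_const_nhds (x := (0 : Lp ℝ 2 m)))).inf_nhds
      (tendsto_const_nhds (x := toL2 m χ))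
    simpa only [hφL, ZeroMemClass.coe_zero, sup_idem, h0] using this
  obtain ⟨f, hf, -, hconv⟩ := hR.exists_convexHull
    (u := fun n => Submodule.inclusion hle ⟨toL2 m (φ n), hφA n⟩)
    (B := 6 * B + 4 * Q.form ⟨toL2 m χ, hχ⟩ + ∫ x : O, χ x ^ 2 ∂μ) (y := 0)
    (fun n => by
      rw [hform, addMeasure_form_of_eq (hφO n) rfl]
      refine add_le_add (hφB n) (integral_mono (hsq _ (hφO n)) (hsq χ hχO) fun x => ?_)
      exact pow_le_pow_left₀ (le_inf le_sup_right (hχ0 x)) inf_le_right 2)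
    hlimφ
  obtain rfl : f = 0 := Subtype.ext hf
  have hKfin : μ K < ∞ := hK.measure_lt_top
  refine (measureReal_eq_zero_iff hKfin.ne).1 (le_antisymm
    (le_of_forall_pos_lt_add fun ε hε => ?_) measureReal_nonneg)
  obtain ⟨w, hw, hwε⟩ := hconv ε hε
  have hcvx : Convex ℝ {w : R.domain | ∃ ψ : C_c(X, ℝ), toL2 m ψ = w ∧ tsupport ψ ⊆ O ∧
      (w : Lp ℝ 2 m) ∈ (Q.addMeasure μ).domain ∧ ∀ x ∈ Subtype.val '' K, 1 ≤ ψ x} := by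
    rintro w ⟨ψ, hψ, hψO, hwA, hψ1⟩ w' ⟨ψ', hψ', hψO', hwA', hψ1'⟩ a b ha hb hab
    refine ⟨a • ψ + b • ψ', by simp [hψ, hψ'],
      (ccOn O).add_mem ((ccOn O).smul_mem a hψO) ((ccOn O).smul_mem b hψO'),
      Submodule.add_mem _ (Submodule.smul_mem _ a hwA) (Submodule.smul_mem _ b hwA'),
      fun x hx => ?_⟩
    have h1 := mul_le_mul_of_nonneg_left (hψ1 x hx) ha
    have h2 := mul_le_mul_of_nonneg_left (hψ1' x hx) hb
    change 1 ≤ a * ψ x + b * ψ' x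
    linarith
  have hsub := convexHull_min (s := Set.range
    fun n => Submodule.inclusion hle ⟨toL2 m (φ n), hφA n⟩) (by
      rintro _ ⟨n, rfl⟩
      exact ⟨φ n, rfl, hφO n, hφA n, fun x hx =>
        le_inf ((hv1 n x hx).trans le_sup_left) (hχK x hx).ge⟩) hcvx
  obtain ⟨ψ, hψ, hψO, hwA, hψ1⟩ := hsub hw
  have h1 : R.form w = (Q.addMeasure μ).form ⟨w, hwA⟩ := hform ⟨w, hwA⟩
  rw [addMeasure_form_of_eq hψO hψ] at h1
  have h2 : μ.real K ≤ ∫ x : O, ψ x ^ 2 ∂μ := by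
    rw [← integral_indicator_one hK.measurableSet]
    refine integral_mono ((integrable_indicator_iff hK.measurableSet).2
      (integrableOn_const hKfin.ne)) (hsq ψ hψO) fun x => ?_
    by_cases hx : x ∈ K
    · rw [Set.indicator_of_mem hx]
      exact one_le_pow₀ (hψ1 x ⟨x, hx, rfl⟩)
    · rw [Set.indicator_of_notMem hx]
      exact sq_nonneg _
  rw [sub_zero] at hwε
  linarith [Q.nonneg ⟨w, hwA.1⟩, R.form_le_normSq w]

theorem chargesNoPolarSet_of_isClosable [TopologicalSpace.SeparableSpace X] (hQ : Q.IsDirichlet)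
    (hreg : Q.IsRegular) {O : Set X} (hO : IsOpen O) {μ : Measure O} [μ.Regular]
    (hcl : (Q.addMeasure μ).IsClosable) : Q.ChargesNoPolarSet μ := by
  intro A hA hcap
  have : LocallyCompactSpace O := hO.locallyCompactSpace
  have : SecondCountableTopology X := UniformSpace.secondCountable_of_separable X
  rw [hA.measure_eq_iSup_isCompact]
  refine le_antisymm (iSup₂_le fun K hKA => iSup_le fun hK => le_of_eq ?_) zero_le
  exact measure_eq_zero_of_isClosable hQ hreg hO hcl hK
    (le_antisymm ((cap_mono (Set.image_mono hKA)).trans hcap.le) zero_le)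

end Closable

end NonnegForm

/-! ### The perturbed form -/

namespace NonnegForm

section PerturbedForm

variable {X : Type*} [TopologicalSpace X] [MeasurableSpace X] {m : Measure X}
  {Q : NonnegForm (Lp ℝ 2 m)} {O : Set X} {μ : Measure O}

/-- `h` is a quasi continuous representative of `f` which vanishes quasi everywhere off `O` and is
square integrable with respect to `μ`. -/
def IsAdmissibleRep (Q : NonnegForm (Lp ℝ 2 m)) (μ : Measure O) (f : Lp ℝ 2 m) (h : X → ℝ) :
    Prop :=
  Q.IsRealRep f h ∧ Q.QuasiEverywhere (fun x => x ∉ O → h x = 0) ∧ MemLp (fun x : O => h x) 2 μ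

theorem IsAdmissibleRep.add (hQ : Q.IsDirichlet) {f g : Lp ℝ 2 m} {h k : X → ℝ}
    (hh : Q.IsAdmissibleRep μ f h) (hk : Q.IsAdmissibleRep μ g k) :
    Q.IsAdmissibleRep μ (f + g) fun x => h x + k x :=
  ⟨hh.1.add hQ hk.1, (hQ.quasiEverywhere_and hh.2.1 hk.2.1).mono fun x hx hxO => by
    simp [hx.1 hxO, hx.2 hxO], hh.2.2.add hk.2.2⟩

theorem IsAdmissibleRep.smul {f : Lp ℝ 2 m} {h : X → ℝ} (hh : Q.IsAdmissibleRep μ f h) (c : ℝ) :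
    Q.IsAdmissibleRep μ (c • f) fun x => c * h x :=
  ⟨hh.1.smul c, hh.2.1.mono fun x hx hxO => by simp [hx hxO], hh.2.2.const_mul c⟩

theorem isAdmissibleRep_zero [OpensMeasurableSpace X] : Q.IsAdmissibleRep μ 0 fun _ => 0 := by
  refine ⟨⟨isRealQuasiContinuous_of_continuous continuous_const, ?_⟩,
    quasiEverywhere_of_forall fun _ _ => rfl, MemLp.zero'⟩
  filter_upwards [Lp.coeFn_zero ℝ 2 m] with x hx using hx.symm

/-- A quasi continuous function dominated by an admissible one is admissible. -/
theorem IsAdmissibleRep.of_abs_le {f g : Lp ℝ 2 m} {h k : X → ℝ} (hh : Q.IsAdmissibleRep μ f h)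
    (hk : Q.IsRealRep g k) (hle : ∀ x, |k x| ≤ |h x|) : Q.IsAdmissibleRep μ g k := by
  refine ⟨hk, hh.2.1.mono fun x hx hxO => ?_, ?_⟩
  · have := hle x
    rw [hx hxO, abs_zero] at this
    exact abs_eq_zero.1 (le_antisymm this (abs_nonneg _))
  · exact hh.2.2.of_le (hk.1.1.comp measurable_subtype_coe).aestronglyMeasurable
      (Eventually.of_forall fun x => hle x)

theorem IsAdmissibleRep.sup_zero {f : Lp ℝ 2 m} {h : X → ℝ} (hh : Q.IsAdmissibleRep μ f h) :
    Q.IsAdmissibleRep μ (f ⊔ 0) fun x => max (h x) 0 :=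
  hh.of_abs_le hh.1.sup_zero fun x => by
    rw [abs_of_nonneg (le_max_right _ _)]
    exact max_le (le_abs_self _) (abs_nonneg _)

/-- Admissibility does not depend on the choice of the quasi continuous representative. -/
theorem IsAdmissibleRep.congr [BorelSpace X] (hQ : Q.IsDirichlet) (hμ : Q.ChargesNoPolarSet μ)
    {f : Lp ℝ 2 m} {h k : X → ℝ} (hh : Q.IsAdmissibleRep μ f h) (hk : Q.IsRealRep f k) :
    Q.IsAdmissibleRep μ f k := by
  have heq := hh.1.eq hQ hk
  have hae : (fun x : O => h x) =ᵐ[μ] fun x : O => k x := hμ.ae heq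
  exact ⟨hk, (hQ.quasiEverywhere_and heq hh.2.1).mono fun x hx hxO =>
    hx.1.symm.trans (hx.2 hxO), (memLp_congr_ae hae).1 hh.2.2⟩

theorem IsAdmissibleRep.ae_eq [BorelSpace X] (hQ : Q.IsDirichlet) (hμ : Q.ChargesNoPolarSet μ)
    {f : Lp ℝ 2 m} {h k : X → ℝ} (hh : Q.IsAdmissibleRep μ f h) (hk : Q.IsAdmissibleRep μ f k) :
    (fun x : O => h x) =ᵐ[μ] fun x : O => k x :=
  hμ.ae (hh.1.eq hQ hk.1)

variable [BorelSpace X]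

/-- The space of those `f ∈ D(Q)` which have an admissible representative. -/
def perturbedDomain (hQ : Q.IsDirichlet) (μ : Measure O) : Submodule ℝ (Lp ℝ 2 m) where
  carrier := {f | f ∈ Q.domain ∧ ∃ h, Q.IsAdmissibleRep μ f h}
  add_mem' := by
    rintro f g ⟨hf, h, hh⟩ ⟨hg, k, hk⟩
    exact ⟨Q.domain.add_mem hf hg, _, hh.add hQ hk⟩
  zero_mem' := ⟨Q.domain.zero_mem, _, isAdmissibleRep_zero⟩
  smul_mem' := by
    rintro c f ⟨hf, h, hh⟩
    exact ⟨Q.domain.smul_mem c hf, _, hh.smul c⟩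

theorem perturbedDomain_le (hQ : Q.IsDirichlet) (μ : Measure O) :
    perturbedDomain hQ μ ≤ Q.domain :=
  fun _ hf => hf.1

/-- The map sending `f` to the class of its quasi continuous representative in `L²(O, μ)`. It is
well defined and linear as `μ` charges no polar set. -/
noncomputable def traceMap (hQ : Q.IsDirichlet) (hμ : Q.ChargesNoPolarSet μ) :
    perturbedDomain hQ μ →ₗ[ℝ] Lp ℝ 2 μ where
  toFun f := f.2.2.choose_spec.2.2.toLp _
  map_add' f g := by
    rw [← MemLp.toLp_add, MemLp.toLp_eq_toLp_iff]
    exact (f + g).2.2.choose_spec.ae_eq hQ hμ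
      (f.2.2.choose_spec.add hQ g.2.2.choose_spec)
  map_smul' c f := by
    rw [RingHom.id_apply, ← MemLp.toLp_const_smul, MemLp.toLp_eq_toLp_iff]
    exact (c • f).2.2.choose_spec.ae_eq hQ hμ (f.2.2.choose_spec.smul c)

theorem coeFn_traceMap (hQ : Q.IsDirichlet) (hμ : Q.ChargesNoPolarSet μ)
    {f : perturbedDomain hQ μ} {h : X → ℝ} (hh : Q.IsRealRep f h) :
    ∀ᵐ x : O ∂μ, traceMap hQ hμ f x = h x := by
  filter_upwards [f.2.2.choose_spec.2.2.coeFn_toLp, hμ.ae (f.2.2.choose_spec.1.eq hQ hh)]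
    with x h1 h2
  exact h1.trans h2

/-- The form `f ↦ Q(f) + ∫_O f̃² dμ` on the space of all `f ∈ D(Q)` whose quasi continuous
representative `f̃` vanishes quasi everywhere off `O` and is square integrable with respect to
`μ`. -/
noncomputable def perturbedForm (hQ : Q.IsDirichlet) (hμ : Q.ChargesNoPolarSet μ) :
    NonnegForm (Lp ℝ 2 m) where
  domain := perturbedDomain hQ μ
  form := Q.form.comp (Submodule.inclusion (perturbedDomain_le hQ μ)) +
    (LinearMap.BilinMap.toQuadraticMap (innerₗ (Lp ℝ 2 μ))).comp (traceMap hQ hμ)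
  nonneg f := add_nonneg (Q.nonneg _)
    (real_inner_self_nonneg : 0 ≤ inner ℝ (traceMap hQ hμ f) (traceMap hQ hμ f))

theorem perturbedForm_form (hQ : Q.IsDirichlet) (hμ : Q.ChargesNoPolarSet μ)
    (f : (perturbedForm hQ hμ).domain) :
    (perturbedForm hQ hμ).form f = Q.form ⟨f, f.2.1⟩ + ‖traceMap hQ hμ f‖ ^ 2 := by
  rw [← real_inner_self_eq_norm_sq]
  rfl

theorem norm_traceMap_sq (hQ : Q.IsDirichlet) (hμ : Q.ChargesNoPolarSet μ)
    {f : perturbedDomain hQ μ} {h : X → ℝ} (hh : Q.IsRealRep f h) :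
    ‖traceMap hQ hμ f‖ ^ 2 = ∫ x : O, h x ^ 2 ∂μ := by
  rw [← real_inner_self_eq_norm_sq, L2.inner_def]
  refine integral_congr_ae ?_
  filter_upwards [coeFn_traceMap hQ hμ hh] with x hx
  simp [hx, sq]

theorem perturbedForm_normSq (hQ : Q.IsDirichlet) (hμ : Q.ChargesNoPolarSet μ)
    (f : (perturbedForm hQ hμ).domain) :
    (perturbedForm hQ hμ).normSq f = Q.normSq ⟨f, f.2.1⟩ + ‖traceMap hQ hμ f‖ ^ 2 := by
  rw [normSq, normSq, perturbedForm_form]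
  ring

/-- The perturbed form is closed: convergence in `D(Q)` implies convergence quasi everywhere, hence
`μ`-almost everywhere, along a subsequence, so the limits in `D(Q)` and in `L²(O, μ)` match. -/
theorem perturbedForm_isClosed [IsFiniteMeasureOnCompacts m] (hQ : Q.IsDirichlet)
    (hreg : Q.IsRegular) (hμ : Q.ChargesNoPolarSet μ) : (perturbedForm hQ hμ).IsClosed := by
  intro u hu
  have hsub : ∀ n k, (perturbedForm hQ hμ).normSq (u n - u k) =
      Q.normSq (⟨u n, (u n).2.1⟩ - ⟨u k, (u k).2.1⟩) +
        ‖traceMap hQ hμ (u n) - traceMap hQ hμ (u k)‖ ^ 2 := fun n k =>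
    (perturbedForm_normSq hQ hμ _).trans (congrArg (fun z => _ + ‖z‖ ^ 2)
      (map_sub (traceMap hQ hμ) (u n) (u k)))
  obtain ⟨f, hf⟩ := hQ.2.1 (fun n => ⟨u n, (u n).2.1⟩) (by
    intro ε hε
    obtain ⟨N, hN⟩ := hu ε hε
    refine ⟨N, fun n k hn hk => lt_of_le_of_lt ?_ (hN n k hn hk)⟩
    rw [hsub]
    exact le_add_of_nonneg_right (sq_nonneg _))
  have hcauchy : CauchySeq fun n => traceMap hQ hμ (u n) := by
    rw [Metric.cauchySeq_iff]
    intro ε hε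
    obtain ⟨N, hN⟩ := hu (ε ^ 2) (by positivity)
    refine ⟨N, fun n hn k hk => ?_⟩
    rw [dist_eq_norm]
    refine lt_of_pow_lt_pow_left₀ 2 hε.le (lt_of_le_of_lt ?_ (hN n k hn hk))
    rw [hsub]
    exact le_add_of_nonneg_left (Q.normSq_nonneg _)
  obtain ⟨t, ht⟩ := cauchySeq_tendsto_of_complete hcauchy
  obtain ⟨ns, hns, hae⟩ := (tendstoInMeasure_of_tendsto_Lp ht).exists_seq_tendsto_ae
  obtain ⟨ks, hks, hfast⟩ := extraction_forall_of_eventually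
    (P := fun j k => Q.normSq (⟨u (ns k), (u (ns k)).2.1⟩ - f) ≤ (1 / 32) ^ j) fun j =>
      ((hf.comp hns.tendsto_atTop).eventually (gt_mem_nhds
        (show (0 : ℝ) < (1 / 32) ^ j by positivity))).mono fun _ h => le_of_lt h
  choose h hh using fun n => (u n).2.2
  obtain ⟨k, hk⟩ := hreg.exists_isRealRep hQ f
  have hqe : Q.QuasiEverywhere fun x => Tendsto (fun j => h (ns (ks j)) x) atTop (𝓝 (k x)) :=
    (hQ.quasiEverywhere_tendsto_zero (fun j => (hh (ns (ks j))).1.sub hQ hk) hfast).mono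
      fun x hx => by simpa using hx.add_const (k x)
  have hkt : ∀ᵐ x : O ∂μ, t x = k x := by
    filter_upwards [hae, hμ.ae hqe, ae_all_iff.2 fun n => coeFn_traceMap hQ hμ (hh n).1]
      with x h1 h2 h3
    simp only [h3] at h1
    exact tendsto_nhds_unique (h1.comp hks.tendsto_atTop) h2
  have hadm : Q.IsAdmissibleRep μ f k := by
    refine ⟨hk, ?_, (memLp_congr_ae hkt).1 (Lp.memLp t)⟩
    refine (hQ.quasiEverywhere_and hqe (hQ.quasiEverywhere_all fun j =>
      (hh (ns (ks j))).2.1)).mono fun x hx hxO => ?_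
    refine tendsto_nhds_unique hx.1 ?_
    simp only [hx.2 _ hxO]
    exact tendsto_const_nhds
  have htr : traceMap hQ hμ ⟨f, f.2, k, hadm⟩ = t := by
    rw [Lp.ext_iff]
    filter_upwards [hkt, coeFn_traceMap hQ hμ (f := ⟨f, f.2, k, hadm⟩) hk] with x h1 h2
    rw [h1, h2]
  refine ⟨⟨f, f.2, k, hadm⟩, ?_⟩
  have h1 : ∀ n, (perturbedForm hQ hμ).normSq (u n - ⟨f, f.2, k, hadm⟩) =
      Q.normSq (⟨u n, (u n).2.1⟩ - f) + ‖traceMap hQ hμ (u n) - t‖ ^ 2 := fun n => by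
    rw [← htr]
    exact (perturbedForm_normSq hQ hμ _).trans (congrArg (fun z => _ + ‖z‖ ^ 2)
      (map_sub (traceMap hQ hμ) (u n) ⟨f, f.2, k, hadm⟩))
  simp only [h1]
  simpa using hf.add ((tendsto_iff_norm_sub_tendsto_zero.1 ht).pow 2)

variable [IsFiniteMeasureOnCompacts m] [IsFiniteMeasureOnCompacts μ]

theorem isAdmissibleRep_toL2 {φ : C_c(X, ℝ)} (hφ : tsupport φ ⊆ O) :
    Q.IsAdmissibleRep μ (toL2 m φ) φ := by
  refine ⟨isRealRep_toL2 φ, quasiEverywhere_of_forall fun x hx =>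
    image_eq_zero_of_notMem_tsupport fun h => hx (hφ h), ?_⟩
  refine (memLp_two_iff_integrable_sq
    (φ.continuous.measurable.comp measurable_subtype_coe).aestronglyMeasurable).2 ?_
  refine (integrable_mul_ccOn μ ⟨φ, hφ⟩ ⟨φ, hφ⟩).congr (Eventually.of_forall fun x => ?_)
  exact (sq (φ x)).symm

theorem perturbedForm_extends [m.IsOpenPosMeasure] (hQ : Q.IsDirichlet)
    (hμ : Q.ChargesNoPolarSet μ) :
    (perturbedForm hQ hμ).Extends (Q.addMeasure μ) := by
  have hle : (Q.addMeasure μ).domain ≤ (perturbedForm hQ hμ).domain := fun f hf => by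
    obtain ⟨hfQ, φ, hφ, rfl⟩ := (mem_addMeasure_domain Q μ f).1 hf
    exact ⟨hfQ, φ, isAdmissibleRep_toL2 hφ⟩
  refine ⟨hle, fun ⟨f, hf⟩ => ?_⟩
  obtain ⟨hfQ, φ, hφ, rfl⟩ := (mem_addMeasure_domain Q μ f).1 hf
  rw [addMeasure_form Q μ φ hφ hf]
  exact (perturbedForm_form hQ hμ _).trans
    (congrArg (_ + ·) (norm_traceMap_sq hQ hμ (isRealRep_toL2 φ)))

end PerturbedForm

end NonnegForm

/-! ### Density of the compactly supported continuous functions -/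

namespace NonnegForm

section Density

variable {X : Type*} [TopologicalSpace X] [MeasurableSpace X] [BorelSpace X] {m : Measure X}
  [IsFiniteMeasureOnCompacts m] [m.IsOpenPosMeasure] {Q : NonnegForm (Lp ℝ 2 m)} {O : Set X}
  {μ : Measure O} [IsFiniteMeasureOnCompacts μ]

/-- The closure of `D(Q) ∩ C_c(O)` in the domain of the perturbed form. -/
noncomputable def coreClosure (hQ : Q.IsDirichlet) (hμ : Q.ChargesNoPolarSet μ) :
    Submodule ℝ (Lp ℝ 2 m) :=
  ((perturbedForm hQ hμ).formClosure (Q.addMeasure μ).domain).map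
    (perturbedForm hQ hμ).domain.subtype

theorem toL2_mem_coreClosure (hQ : Q.IsDirichlet) (hμ : Q.ChargesNoPolarSet μ) {φ : C_c(X, ℝ)}
    (hφ : tsupport φ ⊆ O) (hφQ : toL2 m φ ∈ Q.domain) : toL2 m φ ∈ coreClosure hQ hμ :=
  ⟨⟨toL2 m φ, hφQ, φ, isAdmissibleRep_toL2 hφ⟩, mem_formClosure_of_mem _
    ((mem_addMeasure_domain Q μ _).2 ⟨hφQ, φ, hφ, rfl⟩), rfl⟩

/-- The closure of `D(Q) ∩ C_c(O)` is stable under limits in `L²(X, m)` of sequences which are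
bounded in the form norm. -/
theorem mem_coreClosure_of_tendsto (hQ : Q.IsDirichlet) (hreg : Q.IsRegular)
    (hμ : Q.ChargesNoPolarSet μ) {F : ℕ → Lp ℝ 2 m} (hF : ∀ n, F n ∈ coreClosure hQ hμ)
    (hFQ : ∀ n, F n ∈ Q.domain) {B : ℝ} (hB : ∀ n, Q.form ⟨F n, hFQ n⟩ ≤ B) {k : ℕ → X → ℝ}
    (hk : ∀ n, Q.IsRealRep (F n) (k n)) {κ : O → ℝ} (hκ : MemLp κ 2 μ)
    (hle : ∀ n, ∀ x : O, |k n x| ≤ |κ x|) {f : Lp ℝ 2 m} (hf : Tendsto F atTop (𝓝 f)) :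
    f ∈ coreClosure hQ hμ := by
  choose u hu huF using hF
  change ∀ n, (u n : Lp ℝ 2 m) = F n at huF
  have hbound : ∀ n, (perturbedForm hQ hμ).form (u n) ≤ B + ∫ x, κ x ^ 2 ∂μ := by
    intro n
    have hkn : Q.IsRealRep (u n : Lp ℝ 2 m) (k n) := (huF n).symm ▸ hk n
    refine (perturbedForm_form hQ hμ (u n)).trans_le (add_le_add ?_ ?_)
    · exact (congrArg Q.form (Subtype.ext (huF n))).trans_le (hB n)
    · refine (norm_traceMap_sq hQ hμ (f := u n) hkn).trans_le ?_
      refine integral_mono_of_nonneg (Eventually.of_forall fun x => sq_nonneg _) hκ.integrable_sq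
        (Eventually.of_forall fun x => ?_)
      exact sq_le_sq.2 (hle n x)
  have hlim : Tendsto (fun n => (u n : Lp ℝ 2 m)) atTop (𝓝 f) := by simpa only [huF] using hf
  obtain ⟨g, rfl, -⟩ := (perturbedForm_isClosed hQ hreg hμ).exists_convexHull hbound hlim
  exact ⟨g, (perturbedForm_isClosed hQ hreg hμ).mem_formClosure_of_tendsto hu hbound hlim, rfl⟩

/-- Bounded functions in `D(Q)` with compact support in `O` are approximable: cut off a regular
approximation by a multiple of a cutoff function. -/
theorem mem_coreClosure_of_isCompact [T2Space X] [LocallyCompactSpace X] (hQ : Q.IsDirichlet)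
    (hreg : Q.IsRegular) (hμ : Q.ChargesNoPolarSet μ) (hO : IsOpen O) {f : Lp ℝ 2 m}
    (hf : f ∈ Q.domain) (hf0 : 0 ≤ f) {N : ℝ} (hN : 0 ≤ N) (hfN : ∀ᵐ x ∂m, f x ≤ N) {K : Set X}
    (hK : IsCompact K) (hKO : K ⊆ O) (hfK : ∀ᵐ x ∂m, x ∉ K → f x = 0) :
    f ∈ coreClosure hQ hμ := by
  obtain ⟨χ, hχ, hχO, hχ0, -, hχK⟩ := hreg.exists_cutoff hQ hK hO hKO
  obtain ⟨ψ, hψ, B, hlim, hB⟩ := hreg.exists_seq ⟨f, hf⟩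
  have hNχ : toL2 m (N • χ) ∈ Q.domain := by
    rw [map_smul]
    exact Q.domain.smul_mem N hχ
  have hNχ0 : ∀ x, 0 ≤ (N • χ) x := fun x => mul_nonneg hN (hχ0 x)
  have hNχO : tsupport (N • χ : C_c(X, ℝ)) ⊆ O := (ccOn O).smul_mem N hχO
  have hL : ∀ n, toL2 m ((ψ n ⊔ 0) ⊓ (N • χ)) = (toL2 m (ψ n) ⊔ 0) ⊓ toL2 m (N • χ) := fun n => by
    rw [toL2_inf, toL2_sup_zero]
  have hLQ : ∀ n, toL2 m ((ψ n ⊔ 0) ⊓ (N • χ)) ∈ Q.domain := fun n =>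
    hL n ▸ hQ.inf_mem (hQ.sup_zero_mem (hψ n)) hNχ
  have hLO : ∀ n, tsupport ((ψ n ⊔ 0) ⊓ (N • χ) : C_c(X, ℝ)) ⊆ O := fun n =>
    (tsupport_sup_zero_inf_subset _).trans hNχO
  have hfχ : (f ⊔ 0) ⊓ toL2 m (N • χ) = f := by
    rw [sup_eq_left.2 hf0, inf_eq_left, ← Lp.coeFn_le]
    filter_upwards [hfN, hfK, coeFn_toL2 (m := m) (N • χ)] with x h1 h2 h3
    rw [h3]
    by_cases hx : x ∈ K
    · change f x ≤ N * χ x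
      rwa [hχK x hx, mul_one]
    · rw [h2 hx]
      exact hNχ0 x
  refine mem_coreClosure_of_tendsto hQ hreg hμ (F := fun n => toL2 m ((ψ n ⊔ 0) ⊓ (N • χ)))
    (fun n => toL2_mem_coreClosure hQ hμ (hLO n) (hLQ n)) hLQ
    (B := 6 * B + 4 * Q.form ⟨_, hNχ⟩) (fun n => ?_) (fun n => isRealRep_toL2 _)
    (κ := fun x => (N • χ) x) (isAdmissibleRep_toL2 (Q := Q) hNχO).2.2 (fun n x => ?_) ?_
  · have h1 := hQ.form_inf_le (hQ.sup_zero_mem (hψ n)) hNχ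
    have h2 := hQ.form_sup_zero_le (hψ n)
    simp only [hL]
    linarith [hB n]
  · have h0 : 0 ≤ ((ψ n ⊔ 0) ⊓ (N • χ) : C_c(X, ℝ)) x := le_inf le_sup_right (hNχ0 x)
    rw [abs_of_nonneg h0, abs_of_nonneg (hNχ0 x)]
    exact inf_le_right
  · have := (hlim.sup_nhds (tendsto_const_nhds (x := (0 : Lp ℝ 2 m)))).inf_nhds
      (tendsto_const_nhds (x := toL2 m (N • χ)))
    simpa only [hL, hfχ] using this

/-- The set `A` need not be compact: the infimum of `f` and a regular approximation `ψ₊` of `f` has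
compact support in `A`. -/
theorem mem_coreClosure_of_isClosed [T2Space X] [LocallyCompactSpace X] (hQ : Q.IsDirichlet)
    (hreg : Q.IsRegular) (hμ : Q.ChargesNoPolarSet μ) (hO : IsOpen O) {f : Lp ℝ 2 m}
    (hf : f ∈ Q.domain) (hf0 : 0 ≤ f) {h : X → ℝ} (hh : Q.IsAdmissibleRep μ f h) {N : ℝ}
    (hN : 0 ≤ N) (hfN : ∀ᵐ x ∂m, f x ≤ N) {A : Set X} (hA : _root_.IsClosed A) (hAO : A ⊆ O)
    (hfA : ∀ᵐ x ∂m, x ∉ A → f x = 0) : f ∈ coreClosure hQ hμ := by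
  obtain ⟨ψ, hψ, B, hlim, hB⟩ := hreg.exists_seq ⟨f, hf⟩
  have hh' := hh.sup_zero
  rw [sup_eq_left.2 hf0] at hh'
  refine mem_coreClosure_of_tendsto hQ hreg hμ (F := fun n => f ⊓ (toL2 m (ψ n) ⊔ 0))
    (fun n => ?_) (fun n => hQ.inf_mem hf (hQ.sup_zero_mem (hψ n)))
    (B := 6 * Q.form ⟨f, hf⟩ + 4 * B) (fun n => ?_)
    (fun n => hh'.1.inf hQ (isRealRep_toL2 (ψ n)).sup_zero) hh'.2.2 (fun n x => ?_) ?_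
  · refine mem_coreClosure_of_isCompact hQ hreg hμ hO (hQ.inf_mem hf (hQ.sup_zero_mem (hψ n)))
      (le_inf hf0 le_sup_right) hN ?_ (K := A ∩ tsupport (ψ n))
      ((ψ n).hasCompactSupport.isCompact.inter_left hA)
      (Set.inter_subset_left.trans hAO) ?_
    · filter_upwards [hfN, (Lp.coeFn_le _ _).2 (inf_le_left : f ⊓ (toL2 m (ψ n) ⊔ 0) ≤ f)]
        with x h1 h2 using h2.trans h1
    · filter_upwards [hfA, Lp.coeFn_inf f (toL2 m (ψ n) ⊔ 0), coeFn_sup_zero (toL2 m (ψ n)),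
        coeFn_toL2 (m := m) (ψ n), (Lp.coeFn_nonneg _).2 hf0] with x h1 h2 h3 h4 h5 hx
      rw [h2, Pi.inf_apply, h3, h4]
      rw [Pi.zero_apply] at h5
      by_cases hxA : x ∈ A
      · rw [image_eq_zero_of_notMem_tsupport fun h => hx ⟨hxA, h⟩, max_self]
        exact inf_eq_right.2 h5
      · rw [h1 hxA]
        exact inf_eq_left.2 (le_max_right _ _)
  · have h1 := hQ.form_inf_le hf (hQ.sup_zero_mem (hψ n))
    have h2 := hQ.form_sup_zero_le (hψ n)
    linarith [hB n]
  · rw [abs_of_nonneg (le_min (le_max_right _ _) (le_max_right _ _)),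
      abs_of_nonneg (le_max_right _ _)]
    exact min_le_left _ _
  · have := (tendsto_const_nhds (x := f)).inf_nhds
      (hlim.sup_nhds (tendsto_const_nhds (x := (0 : Lp ℝ 2 m))))
    simpa only [sup_eq_left.2 hf0, inf_idem] using this

/-- For bounded `f ≥ 0` with an admissible representative `h`, the function `(f - ε)₊` is
approximable. Off an open set `U` of small capacity `h` is continuous and vanishes outside `O`, so
`{h ≥ ε} \ U` is a closed subset of `O`. If `e ≥ 1` on `U` has small form norm, then
`((f - ε)₊ - N e)₊` is close to `(f - ε)₊` in `L²(X, m)` and vanishes off this closed set. -/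
theorem mem_coreClosure_of_sub_const [T2Space X] [LocallyCompactSpace X] (hQ : Q.IsDirichlet)
    (hreg : Q.IsRegular) (hμ : Q.ChargesNoPolarSet μ) (hO : IsOpen O) {f g : Lp ℝ 2 m}
    {h : X → ℝ} (hh : Q.IsAdmissibleRep μ f h) (hh0 : ∀ x, 0 ≤ h x) {N : ℝ}
    (hN : 0 ≤ N) (hfN : ∀ᵐ x ∂m, f x ≤ N) {ε : ℝ} (hε : 0 < ε) (hg : g ∈ Q.domain)
    (hgf : ∀ᵐ x ∂m, g x = max (f x - ε) 0) : g ∈ coreClosure hQ hμ := by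
  have hgrep : Q.IsRealRep g fun x => max (h x - ε) 0 := by
    refine ⟨hh.1.1.comp (F := fun y => max (y - ε) 0) (by fun_prop), ?_⟩
    filter_upwards [hh.1.2, hgf] with x h1 h2
    rw [h1, h2]
  have hU : ∀ n : ℕ, ∃ U, IsOpen U ∧ Q.capOpen U < ENNReal.ofReal (1 / ((n : ℝ) + 1)) ∧
      ContinuousOn h Uᶜ ∧ ∀ x ∉ U, x ∉ O → h x = 0 := by
    intro n
    have hn : (0 : ℝ) < 1 / ((n : ℝ) + 1) := Nat.one_div_pos_of_nat
    obtain ⟨U, hU, hUlt, hUc⟩ := hh.1.1.2 (1 / ((n : ℝ) + 1) / 8) (by positivity)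
    obtain ⟨V, hV, hVsub, hVlt⟩ := cap_eq_zero_iff.1 hh.2.1 (1 / ((n : ℝ) + 1) / 8) (by positivity)
    refine ⟨U ∪ V, hU.union hV, (hQ.capOpen_union_le hUlt hVlt).trans_lt
      ((ENNReal.ofReal_lt_ofReal_iff hn).2 (by linarith)),
      hUc.mono (Set.compl_subset_compl.2 Set.subset_union_left), fun x hx => ?_⟩
    by_contra hxO
    exact hx (Or.inr (hVsub hxO))
  choose U hU hUlt hUc hU0 using hU
  choose e he0 he1 he using fun n => hQ.exists_of_capOpen_lt (hUlt n)
  choose k' hk' using fun n => hreg.exists_isRealRep hQ (e n)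
  have hk : ∀ n, Q.IsRealRep (e n : Lp ℝ 2 m) fun x => max (k' n x) 0 := fun n => by
    have := (hk' n).sup_zero
    rwa [sup_eq_left.2 (he0 n)] at this
  have helim : Tendsto (fun n => (e n : Lp ℝ 2 m)) atTop (𝓝 0) := by
    refine Q.tendsto_coe_of_normSq (f := 0) ?_
    refine squeeze_zero (fun _ => Q.normSq_nonneg _) (fun n => ?_)
      tendsto_one_div_add_atTop_nhds_zero_nat
    rw [sub_zero]
    exact (he n).le
  have hg0 : 0 ≤ g := by
    rw [← Lp.coeFn_nonneg]
    filter_upwards [hgf] with x hx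
    rw [hx]
    exact le_max_right _ _
  have hrep : ∀ n, Q.IsRealRep ((g - N • (e n : Lp ℝ 2 m)) ⊔ 0)
      fun x => max (max (h x - ε) 0 - N * max (k' n x) 0) 0 := fun n =>
    (hgrep.sub hQ ((hk n).smul N)).sup_zero
  have hrep_le : ∀ n x, |max (max (h x - ε) 0 - N * max (k' n x) 0) 0| ≤ |h x| := fun n x => by
    rw [abs_of_nonneg (le_max_right _ _), abs_of_nonneg (hh0 x)]
    have h1 : 0 ≤ N * max (k' n x) 0 := by positivity
    have h2 : max (h x - ε) 0 ≤ h x := max_le (by linarith) (hh0 x)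
    exact max_le (by linarith) (hh0 x)
  have hmem : ∀ n, g - N • (e n : Lp ℝ 2 m) ∈ Q.domain := fun n =>
    Q.domain.sub_mem hg (Q.domain.smul_mem N (e n).2)
  refine mem_coreClosure_of_tendsto hQ hreg hμ (F := fun n => (g - N • (e n : Lp ℝ 2 m)) ⊔ 0)
    (fun n => ?_) (fun n => hQ.sup_zero_mem (hmem n))
    (B := 2 * Q.form ⟨g, hg⟩ + 2 * N ^ 2) (fun n => ?_) hrep hh.2.2 (fun n x => hrep_le n x) ?_
  · have hpt : ∀ᵐ x ∂m, ((g - N • (e n : Lp ℝ 2 m)) ⊔ 0 : Lp ℝ 2 m) x =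
        max (max (h x - ε) 0 - N * (e n : Lp ℝ 2 m) x) 0 := by
      filter_upwards [hgrep.2, coeFn_sup_zero (g - N • (e n : Lp ℝ 2 m)),
        Lp.coeFn_sub g (N • (e n : Lp ℝ 2 m)), Lp.coeFn_smul N (e n : Lp ℝ 2 m)] with x h1 h2 h3 h4
      rw [h2, h3, Pi.sub_apply, h4, Pi.smul_apply, smul_eq_mul, ← h1]
    refine mem_coreClosure_of_isClosed hQ hreg hμ hO (hQ.sup_zero_mem (hmem n)) le_sup_right
      (hh.of_abs_le (hrep n) (hrep_le n)) hN ?_ (A := (U n)ᶜ ∩ h ⁻¹' Set.Ici ε)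
      ((hUc n).preimage_isClosed_of_isClosed (hU n).isClosed_compl isClosed_Ici) ?_ ?_
    · filter_upwards [hpt, hfN, hh.1.2, (Lp.coeFn_nonneg _).2 (he0 n)] with x h1 h2 h3 h4
      rw [h1]
      have h5 : 0 ≤ N * (e n : Lp ℝ 2 m) x := mul_nonneg hN h4
      have h6 : max (h x - ε) 0 ≤ N := max_le (by linarith) hN
      exact max_le (by linarith) hN
    · rintro x ⟨hxU, hx⟩
      by_contra hxO
      rw [Set.mem_preimage, hU0 n x hxU hxO] at hx
      exact hε.not_ge hx
    · filter_upwards [hpt, hfN, hh.1.2, he1 n, (Lp.coeFn_nonneg _).2 (he0 n)]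
        with x h1 h2 h3 h4 h5 hx
      rw [h1, max_eq_right_iff]
      by_cases hxU : x ∈ U n
      · have h6 : N * 1 ≤ N * (e n : Lp ℝ 2 m) x := mul_le_mul_of_nonneg_left (h4 hxU) hN
        have h7 : max (h x - ε) 0 ≤ N := max_le (by linarith) hN
        linarith
      · have h6 : h x < ε := not_le.1 fun hle => hx ⟨hxU, hle⟩
        have h7 : 0 ≤ N * (e n : Lp ℝ 2 m) x := mul_nonneg hN h5
        rw [max_eq_right (by linarith)]
        linarith
  · have h1 := hQ.form_sup_zero_le (hmem n)
    have h2 := Q.form_sub_le ⟨g, hg⟩ (N • e n)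
    rw [form_smul] at h2
    have h3 : Q.form (e n) ≤ 1 := (Q.form_le_normSq _).trans ((he n).le.trans (by
      rw [div_le_one (by positivity)]
      linarith [Nat.cast_nonneg (α := ℝ) n]))
    have h4 : N ^ 2 * Q.form (e n) ≤ N ^ 2 * 1 := mul_le_mul_of_nonneg_left h3 (sq_nonneg N)
    refine h1.trans (h2.trans ?_)
    linarith
  · have := ((helim.const_smul N).const_sub g).sup_nhds
      (tendsto_const_nhds (x := (0 : Lp ℝ 2 m)))
    simpa only [smul_zero, sub_zero, sup_eq_left.2 hg0] using this

theorem mem_coreClosure_of_le [T2Space X] [LocallyCompactSpace X] (hQ : Q.IsDirichlet)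
    (hreg : Q.IsRegular) (hμ : Q.ChargesNoPolarSet μ) (hO : IsOpen O) {f : Lp ℝ 2 m}
    (hf : f ∈ Q.domain) (hf0 : 0 ≤ f) {h : X → ℝ} (hh : Q.IsAdmissibleRep μ f h) {N : ℝ}
    (hN : 0 ≤ N) (hfN : ∀ᵐ x ∂m, f x ≤ N) : f ∈ coreClosure hQ hμ := by
  have hh' := hh.sup_zero
  rw [sup_eq_left.2 hf0] at hh'
  choose g hg hgf using fun n : ℕ =>
    hQ.exists_trunc ⟨f, hf⟩ (Nat.one_div_pos_of_nat (α := ℝ) (n := n))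
  refine mem_coreClosure_of_tendsto hQ hreg hμ (F := fun n => f - g n)
    (fun n => ?_) (fun n => Q.domain.sub_mem hf (g n).2) (B := 4 * Q.form ⟨f, hf⟩) (fun n => ?_)
    (fun n => hh'.1.sub hQ (hh'.1.trunc (hg n))) hh'.2.2 (fun n x => ?_) ?_
  · refine mem_coreClosure_of_sub_const hQ hreg hμ hO hh' (fun x => le_max_right _ _) hN hfN
      (Nat.one_div_pos_of_nat (α := ℝ) (n := n)) (Q.domain.sub_mem hf (g n).2) ?_
    filter_upwards [hg n, Lp.coeFn_sub f (g n), (Lp.coeFn_nonneg _).2 hf0] with x h1 h2 h3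
    rw [h2, Pi.sub_apply, h1, max_eq_left (show 0 ≤ f x from h3)]
    rcases le_total (f x) (1 / ((n : ℝ) + 1)) with hle | hle
    · rw [min_eq_left hle, max_eq_right (by linarith), sub_self]
    · rw [min_eq_right hle, max_eq_left (by linarith)]
  · have h1 := Q.form_sub_le ⟨f, hf⟩ (g n)
    refine le_trans h1 ?_
    linarith [hgf n]
  · have h0 : 0 ≤ max (h x) 0 := le_max_right _ _
    have h1 : (0 : ℝ) < 1 / ((n : ℝ) + 1) := Nat.one_div_pos_of_nat
    have h2 : 0 ≤ min (max (max (h x) 0) 0) (1 / ((n : ℝ) + 1)) := le_min (le_max_right _ _) h1.le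
    have h3 : min (max (max (h x) 0) 0) (1 / ((n : ℝ) + 1)) ≤ max (h x) 0 :=
      (min_le_left _ _).trans_eq (max_eq_left h0)
    rw [abs_of_nonneg (by linarith), abs_of_nonneg h0]
    linarith
  · simpa only [sub_zero] using (tendsto_trunc_zero hg).const_sub f

theorem mem_coreClosure_of_nonneg [T2Space X] [LocallyCompactSpace X] (hQ : Q.IsDirichlet)
    (hreg : Q.IsRegular) (hμ : Q.ChargesNoPolarSet μ) (hO : IsOpen O) {f : Lp ℝ 2 m}
    (hf : f ∈ Q.domain) (hf0 : 0 ≤ f) {h : X → ℝ} (hh : Q.IsAdmissibleRep μ f h) :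
    f ∈ coreClosure hQ hμ := by
  choose g hg hgf using fun n : ℕ => hQ.exists_trunc ⟨f, hf⟩ (Nat.cast_add_one_pos (α := ℝ) n)
  have hle : ∀ (n : ℕ) x, |min (max (h x) 0) ((n : ℝ) + 1)| ≤ |h x| := fun n x => by
    rw [abs_of_nonneg (by positivity)]
    exact (min_le_left _ _).trans (max_le (le_abs_self _) (abs_nonneg _))
  refine mem_coreClosure_of_tendsto hQ hreg hμ (F := fun n => (g n : Lp ℝ 2 m))
    (fun n => ?_) (fun n => (g n).2) hgf (fun n => hh.1.trunc (hg n)) hh.2.2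
    (fun n x => hle n x) ?_
  · refine mem_coreClosure_of_le hQ hreg hμ hO (g n).2 ?_
      (hh.of_abs_le (hh.1.trunc (hg n)) (hle n)) (Nat.cast_add_one_pos (α := ℝ) n).le ?_
    · rw [← Lp.coeFn_nonneg]
      filter_upwards [hg n] with x hx
      rw [hx, Pi.zero_apply]
      positivity
    · filter_upwards [hg n] with x hx
      rw [hx]
      exact min_le_right _ _
  · simpa only [sup_eq_left.2 hf0] using tendsto_trunc_atTop hg

theorem mem_coreClosure [T2Space X] [LocallyCompactSpace X] (hQ : Q.IsDirichlet)
    (hreg : Q.IsRegular) (hμ : Q.ChargesNoPolarSet μ) (hO : IsOpen O) {f : Lp ℝ 2 m}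
    (hf : f ∈ Q.domain) {h : X → ℝ} (hh : Q.IsAdmissibleRep μ f h) : f ∈ coreClosure hQ hμ := by
  have h1 : f = f ⊔ 0 - ((-1 : ℝ) • f) ⊔ 0 := by
    rw [Lp.ext_iff]
    filter_upwards [coeFn_sup_zero f, coeFn_sup_zero ((-1 : ℝ) • f), Lp.coeFn_smul (-1 : ℝ) f,
      Lp.coeFn_sub (f ⊔ 0) (((-1 : ℝ) • f) ⊔ 0)] with x h1 h2 h3 h4
    rw [h4, Pi.sub_apply, h1, h2, h3, Pi.smul_apply, smul_eq_mul, neg_one_mul]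
    rcases le_total 0 (f x) with h | h
    · rw [max_eq_left h, max_eq_right (by linarith), sub_zero]
    · rw [max_eq_right h, max_eq_left (by linarith)]
      ring
  rw [h1]
  exact Submodule.sub_mem _
    (mem_coreClosure_of_nonneg hQ hreg hμ hO (hQ.sup_zero_mem hf) le_sup_right hh.sup_zero)
    (mem_coreClosure_of_nonneg hQ hreg hμ hO (hQ.sup_zero_mem (Q.domain.smul_mem _ hf))
      le_sup_right (hh.smul (-1)).sup_zero)

theorem perturbedForm_isClosureOf [T2Space X] [LocallyCompactSpace X] (hQ : Q.IsDirichlet)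
    (hreg : Q.IsRegular) (hμ : Q.ChargesNoPolarSet μ) (hO : IsOpen O) :
    (perturbedForm hQ hμ).IsClosureOf (Q.addMeasure μ) := by
  refine isClosureOf_of_dense (perturbedForm_isClosed hQ hreg hμ) (perturbedForm_extends hQ hμ)
    fun f => ?_
  obtain ⟨hfQ, h, hh⟩ := f.2
  obtain ⟨g, hg, hgf⟩ := mem_coreClosure hQ hreg hμ hO hfQ hh
  obtain rfl : g = f := Subtype.ext hgf
  exact hg

end Density

end NonnegForm

/-! ### Extended-real-valued representatives and the closure -/

namespace NonnegForm

section ExtendedRealAdmissible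

variable {X : Type*} [TopologicalSpace X] [MeasurableSpace X] [BorelSpace X] {m : Measure X}
  {Q : NonnegForm (Lp ℝ 2 m)} {O : Set X} {μ : Measure O}

theorem IsQuasiContinuousRep.lintegral_abs_sq (hμ : Q.ChargesNoPolarSet μ) {f : Lp ℝ 2 m}
    {g : X → EReal} (hg : Q.IsQuasiContinuousRep f g) :
    ∫⁻ x : O, (g x).abs ^ 2 ∂μ = ∫⁻ x : O, ENNReal.ofReal ((g x).toReal ^ 2) ∂μ := by
  refine lintegral_congr_ae ?_
  filter_upwards [hμ.ae hg.coe_toReal] with x hx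
  rw [← hx, EReal.abs_def, EReal.toReal_coe, ← ENNReal.ofReal_pow (abs_nonneg _), sq_abs]

theorem IsQuasiContinuousRep.isAdmissibleRep_iff (hQ : Q.IsDirichlet)
    (hμ : Q.ChargesNoPolarSet μ) {f : Lp ℝ 2 m} {g : X → EReal}
    (hg : Q.IsQuasiContinuousRep f g) :
    Q.IsAdmissibleRep μ f (fun x => (g x).toReal) ↔
      Q.QuasiEverywhere (fun x => x ∉ O → g x = 0) ∧ ∫⁻ x : O, (g x).abs ^ 2 ∂μ < ∞ := by
  have hmeas : AEStronglyMeasurable (fun x : O => (g x).toReal) μ :=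
    (hg.isRealRep.1.1.comp measurable_subtype_coe).aestronglyMeasurable
  have hmem : MemLp (fun x : O => (g x).toReal) 2 μ ↔ ∫⁻ x : O, (g x).abs ^ 2 ∂μ < ∞ := by
    rw [hg.lintegral_abs_sq hμ, memLp_two_iff_integrable_sq hmeas, Integrable,
      hasFiniteIntegral_iff_ofReal (Eventually.of_forall fun x => sq_nonneg _)]
    exact and_iff_right (hmeas.pow 2)
  have hqe : Q.QuasiEverywhere (fun x => x ∉ O → (g x).toReal = 0) ↔
      Q.QuasiEverywhere (fun x => x ∉ O → g x = 0) := by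
    constructor <;> intro h <;>
      refine (hQ.quasiEverywhere_and h hg.coe_toReal).mono fun x hx hxO => ?_
    · rw [← hx.2, hx.1 hxO, EReal.coe_zero]
    · simp [hx.1 hxO]
  rw [← hmem, ← hqe]
  exact and_iff_right hg.isRealRep

end ExtendedRealAdmissible

end NonnegForm

theorem proposition3p1 {X : Type*} [MetricSpace X] [LocallyCompactSpace X]
    [TopologicalSpace.SeparableSpace X] [MeasurableSpace X] [BorelSpace X]
    (m : Measure X) [m.Regular] [m.IsOpenPosMeasure]
    (Q : NonnegForm (Lp ℝ 2 m)) (hQ : Q.IsDirichlet) (hreg : Q.IsRegular)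
    (O : Set X) (hO : IsOpen O) (μ : Measure O) [μ.Regular] :
    (Q.ChargesNoPolarSet μ ↔ (Q.addMeasure μ).IsClosable) ∧
    (Q.ChargesNoPolarSet μ →
      ∃ C : NonnegForm (Lp ℝ 2 m), C.IsClosureOf (Q.addMeasure μ) ∧
        (∀ f : Lp ℝ 2 m, f ∈ C.domain ↔
          f ∈ Q.domain ∧ ∃ g : X → EReal, Q.IsQuasiContinuousRep f g ∧
            Q.QuasiEverywhere (fun x => x ∉ O → g x = 0) ∧
            ∫⁻ x : O, (g x).abs ^ 2 ∂μ < ∞) ∧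
        (∀ (f : Lp ℝ 2 m) (hf : f ∈ C.domain) (hfQ : f ∈ Q.domain) (g : X → EReal),
          Q.IsQuasiContinuousRep f g →
            Q.QuasiEverywhere (fun x => x ∉ O → g x = 0) ∧
            ∫⁻ x : O, (g x).abs ^ 2 ∂μ < ∞ ∧
            C.form ⟨f, hf⟩ = Q.form ⟨f, hfQ⟩ + (∫⁻ x : O, (g x).abs ^ 2 ∂μ).toReal)) := by
  refine ⟨⟨fun hμ => ⟨_, NonnegForm.perturbedForm_isClosed hQ hreg hμ,
    NonnegForm.perturbedForm_extends hQ hμ⟩,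
    NonnegForm.chargesNoPolarSet_of_isClosable hQ hreg hO⟩, fun hμ =>
    ⟨_, NonnegForm.perturbedForm_isClosureOf hQ hreg hμ hO, fun f => ⟨?_, ?_⟩, ?_⟩⟩
  · rintro ⟨hfQ, h, hh⟩
    refine ⟨hfQ, _, hh.1.coe_ereal, (hh.1.coe_ereal.isAdmissibleRep_iff hQ hμ).1 ?_⟩
    simpa only [EReal.toReal_coe] using hh
  · rintro ⟨hfQ, g, hg, hg'⟩
    exact ⟨hfQ, _, (hg.isAdmissibleRep_iff hQ hμ).2 hg'⟩
  · intro f hf hfQ g hg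
    obtain ⟨-, h, hh⟩ := id hf
    have hadm := hh.congr hQ hμ hg.isRealRep
    obtain ⟨h1, h2⟩ := (hg.isAdmissibleRep_iff hQ hμ).1 hadm
    have htrace : ‖NonnegForm.traceMap hQ hμ ⟨f, hf⟩‖ ^ 2 =
        (∫⁻ x : O, (g x).abs ^ 2 ∂μ).toReal := by
      rw [hg.lintegral_abs_sq hμ, NonnegForm.norm_traceMap_sq hQ hμ hg.isRealRep]
      exact integral_eq_lintegral_of_nonneg_ae (Eventually.of_forall fun x => sq_nonneg _)
        hadm.2.2.integrable_sq.aestronglyMeasurable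
    refine ⟨h1, h2, ?_⟩
    rw [← htrace]
    exact NonnegForm.perturbedForm_form hQ hμ ⟨f, hf⟩
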